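/- All graphs are finite, simple and nonempty, and $\log$ is the logarithm in base $2$. For a graph $G$ and $A\subseteq V(G)$ put $B=V(G)\setminus A$, $N(Y)=\bigcup_{y\in Y}N(y)$ and $$\beta_G(A)=\log\bigl|\{X\subseteq A : \exists\, Y\subseteq B \text{ with } N(Y)\setminus B=X\}\bigr| .$$ A decomposition tree of $G$ is a tree $T$ whose internal nodes all have degree $3$, together with a bijection between $V(G)$ and the leaves of $T$. Every edge $uv$ of $T$ induces the partition $\{X_u,X_v\}$ of $V(G)$ given by the leaves of the two components of $T-uv$. The boolean-width $\beta w(G)$ is the minimum, over all decomposition trees of $G$, of the maximum of $\beta_G(X_u)$ over the edges $uv$ of $T$ (the maximum being $0$ if $T$ has no edge, i.e. if $G$ has one vertex). The clique-width $cw(G)$ is the minimum number of labels needed to construct $G$ by the following operations on vertex-labelled graphs: creating a new vertex with label $i$; disjoint union; joining by an edge each vertex with label $i$ to each vertex with label $j$ ($i\neq j$); renaming label $i$ to $j$. For $p,q\ge 2$ the Hsu-grid $HG_{p,q}$ has vertices $v_{i,j}$ ($1\le i\le p$, $1\le j\le q$) and edges $v_{i,j}v_{i+1,j}$ ($1\le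 i<p$, $1\le j\le q$) and $v_{i,j}v_{i',j+1}$ ($1\le i\le i'\le p$, $1\le j<q$). **Theorem.** For every graph $G$, $$\log cw(G)-1\;\le\;\beta w(G)\;\le\; cw(G).$$ Moreover, for every integer $k$ larger than some constant there are a Hsu-grid $L_k$ and a square grid $U_k$, both of clique-width at least $k$, such that $$\beta w(L_k)\le 2\log cw(L_k)+4\qquad\text{and}\qquad \beta w(U_k)\ge \Bigl\lfloor \tfrac16\, cw(U_k)\Bigr\rfloor-1 .$$ -/

import Mathlib

noncomputable section

/-! ### Decomposition trees and the width of a cut function -/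

/-- A decomposition tree of a graph with vertex set `V`: a finite tree in which every internal node
has degree three, together with a bijection `leafEquiv` from `V` to the leaves. A leaf is a node of
degree at most one (degree zero occurs only for the one-node tree, used when `V` is a single
vertex). -/
structure DecompositionTree (V : Type*) where
  Node : Type
  finite_node : Finite Node
  tree : SimpleGraph Node
  isTree : tree.IsTree
  subcubic : ∀ w : Node, (tree.neighborSet w).ncard ≤ 1 ∨ (tree.neighborSet w).ncard = 3
  leafEquiv : V ≃ {w : Node // (tree.neighborSet w).ncard ≤ 1}

/-- For an edge `uv` of the tree, the set `X_u` of the vertices whose leaf lies in the component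
of `u` once the edge `uv` is removed. -/
def DecompositionTree.side {V : Type*} (D : DecompositionTree V) (u v : D.Node) : Set V :=
  {x | (D.tree.deleteEdges {s(u, v)}).Reachable u (D.leafEquiv x : D.Node)}

/-- The `f`-width of a decomposition tree: the maximum of `f (X_u)` over all edges `uv` of the tree
(a finite set of values; the value is `0` for the one-node tree, which has no edge). -/
def DecompositionTree.width {V : Type*} (D : DecompositionTree V) (f : Set V → ℝ) : ℝ :=
  sSup {r | ∃ u v : D.Node, D.tree.Adj u v ∧ f (D.side u v) = r}

/-- The minimum `f`-width over all decomposition trees. For a finite nonempty `V` it is a minimum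
over a finite nonempty set of values. -/
def cutFunctionWidth {V : Type*} (f : Set V → ℝ) : ℝ :=
  sInf {r | ∃ D : DecompositionTree V, D.width f = r}

/-! ### Boolean-width -/

/-- The union of neighbourhoods `N(Y)`. -/
def SimpleGraph.unionNeighbors {V : Type*} (G : SimpleGraph V) (Y : Set V) : Set V :=
  ⋃ y ∈ Y, G.neighborSet y

/-- The boolean-cut function
`β_G(A) = log₂ |{X ⊆ A : ∃ Y ⊆ B, N(Y) \ B = X}|`, where `B = V(G) \ A`. -/
def SimpleGraph.booleanCut {V : Type*} (G : SimpleGraph V) (A : Set V) : ℝ :=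
  Real.logb 2 (({X : Set V | X ⊆ A ∧ ∃ Y : Set V, Y ⊆ Aᶜ ∧ G.unionNeighbors Y \ Aᶜ = X}.ncard : ℕ) : ℝ)

/-- The boolean-width of a graph. -/
def SimpleGraph.booleanWidth {V : Type*} (G : SimpleGraph V) : ℝ :=
  cutFunctionWidth G.booleanCut

/-! ### Clique-width -/

/-- Expressions with labels in `{0, …, k-1}`: creation of a labelled vertex, disjoint union,
joining all vertices with label `i` to all vertices with label `j` (`i ≠ j`), and renaming label
`i` to `j`. -/
inductive CliqueExpr (k : ℕ) : Type where
  | vertex (i : Fin k) : CliqueExpr k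
  | disjUnion (e₁ e₂ : CliqueExpr k) : CliqueExpr k
  | join (i j : Fin k) (hij : i ≠ j) (e : CliqueExpr k) : CliqueExpr k
  | rename (i j : Fin k) (e : CliqueExpr k) : CliqueExpr k

namespace CliqueExpr

/-- The vertex set of the graph constructed by an expression. -/
def Vert {k : ℕ} : CliqueExpr k → Type
  | vertex _ => Unit
  | disjUnion e₁ e₂ => e₁.Vert ⊕ e₂.Vert
  | join _ _ _ e => e.Vert
  | rename _ _ e => e.Vert

/-- The labelling of the vertices constructed by an expression. -/
def label {k : ℕ} : (e : CliqueExpr k) → e.Vert → Fin k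
  | vertex i => fun _ => i
  | disjUnion e₁ e₂ => Sum.elim e₁.label e₂.label
  | join _ _ _ e => e.label
  | rename i j e => fun x => if e.label x = i then j else e.label x

/-- The graph constructed by an expression. -/
def graph {k : ℕ} : (e : CliqueExpr k) → SimpleGraph e.Vert
  | vertex _ => (⊥ : SimpleGraph Unit)
  | disjUnion e₁ e₂ => e₁.graph ⊕g e₂.graph
  | join i j _ e => e.graph ⊔ SimpleGraph.fromRel (fun x y => e.label x = i ∧ e.label y = j)
  | rename _ _ e => e.graph

end CliqueExpr

/-- The clique-width of a (finite nonempty) graph: the minimum number of labels in an expression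
that constructs it, up to isomorphism. -/
def SimpleGraph.cliqueWidth {V : Type*} (G : SimpleGraph V) : ℕ :=
  sInf {k : ℕ | ∃ e : CliqueExpr k, Nonempty (e.graph ≃g G)}

/-! ### Grids -/

/-- The Hsu-grid `HG_{p,q}`. The vertex `(i, j)` lies in row `i` and column `j`; it is joined to
`(i + 1, j)` and to every `(i', j + 1)` with `i ≤ i'`. -/
def hsuGrid (p q : ℕ) : SimpleGraph (Fin p × Fin q) :=
  SimpleGraph.fromRel fun a b =>
    ((a.1 : ℕ) + 1 = b.1 ∧ a.2 = b.2) ∨ (a.1 ≤ b.1 ∧ (a.2 : ℕ) + 1 = b.2)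

/-- The `n × n` grid. -/
def squareGrid (n : ℕ) : SimpleGraph (Fin n × Fin n) :=
  SimpleGraph.pathGraph n □ SimpleGraph.pathGraph n

end

/-! Both widths are controlled by one quantity of a cut: the number `outerClasses S` of distinct
neighbourhoods outside `S` of vertices of `S`. The sets N(Y) \ S with Y ⊆ S are the unions of these
neighbourhoods, so if c is the number of classes, the number of unions lies between c and 2^c. The
number of unions does not depend on the side from which the cut is viewed (`cutUnions_ncard_compl`).
Decomposition trees and clique-width expressions are both compared with `BinaryDecomp`, which builds
the vertex set by disjoint unions.

In an expression with k labels, equally labelled vertices are treated alike by all later operations,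
so every intermediate vertex set has at most k classes (`binaryDecomp_range`). This gives βw ≤ cw.
Conversely, if all sets of a binary decomposition have at most m classes, 2m labels suffice:
disjoint label sets for the two parts, then joins between classes, then merging of the labels that
became equivalent (`IsConstructible.union`). Since m ≤ 2^βw, this gives cw ≤ 2 · 2^βw.

For grids, every binary decomposition contains a set S that splits at least half of the rows, or all
columns (`BinaryDecomp.exists_mixed`). Each split line has an edge crossing the cut. In the square
grid of side 12k, lines of one parity give an induced matching with 3k edges, so βw ≥ 3k, while cw ≤
12k + 2 by a row-by-row construction. In the Hsu-grid of side 4k the crossing edges give only k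
distinct classes, hence cw ≥ k. There the neighbourhoods from one column into the next are nested,
so a union is determined by a threshold; adding columns one vertex at a time meets at most (4k)²
unions, and βw ≤ 2 log(4k) = 2 log k + 4. -/

noncomputable section

/-- A set that is obtained from singletons by successive disjoint unions, all intermediate sets
satisfying `P`. -/
inductive BinaryDecomp {V : Type*} (P : Set V → Prop) : Set V → Prop
  | single (v : V) (h : P {v}) : BinaryDecomp P {v}
  | union {A B : Set V} (hd : Disjoint A B) (hA : BinaryDecomp P A) (hB : BinaryDecomp P B)
      (h : P (A ∪ B)) : BinaryDecomp P (A ∪ B)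

namespace BinaryDecomp

variable {V : Type*} {P Q : Set V → Prop} {A : Set V}

theorem holds (h : BinaryDecomp P A) : P A := by
  cases h <;> assumption

theorem mono (hPQ : ∀ S, P S → Q S) (h : BinaryDecomp P A) : BinaryDecomp Q A := by
  induction h with
  | single v h => exact .single v (hPQ _ h)
  | union hd _ _ h ihA ihB => exact .union hd ihA ihB (hPQ _ h)

end BinaryDecomp

/-! ### The two sides of an edge in a tree. -/

namespace SimpleGraph

/-- The nodes that stay connected to `u` when the edge `uv` is removed. -/
def branch {N : Type*} (T : SimpleGraph N) (u v : N) : Set N :=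
  {w | (T.deleteEdges {s(u, v)}).Reachable u w}

section branch

variable {N : Type*} {T : SimpleGraph N} {u v w x y : N}

theorem mem_branch_self : u ∈ T.branch u v := Reachable.refl u

theorem branch_step (hx : x ∈ T.branch u v) (hxy : T.Adj x y) (hne : s(x, y) ≠ s(u, v)) :
    y ∈ T.branch u v :=
  Reachable.trans hx (Adj.reachable (by simp [deleteEdges_adj, hxy, hne]))

theorem branch_induction {motive : N → Prop} (base : motive u)
    (step : ∀ x y, x ∈ T.branch u v → T.Adj x y → s(x, y) ≠ s(u, v) → motive x → motive y)
    (hx : x ∈ T.branch u v) : motive x := by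
  have hx' := (reachable_iff_reflTransGen _ _).1 hx
  induction hx' with
  | refl => exact base
  | tail hxy hadj ih =>
    have hr : _ ∈ T.branch u v := (reachable_iff_reflTransGen _ _).2 hxy
    rw [deleteEdges_adj] at hadj
    exact step _ _ hr hadj.1 (by simpa using hadj.2) (ih hr)

theorem branch_total (hT : T.Connected) (w : N) : w ∈ T.branch u v ∨ w ∈ T.branch v u := by
  have h := (reachable_iff_reflTransGen _ _).1 (hT.preconnected u w)
  induction h with
  | refl => exact Or.inl mem_branch_self
  | @tail x y _ hadj ih =>
    by_cases hne : s(x, y) = s(u, v)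
    · rcases Sym2.eq_iff.1 hne with ⟨-, rfl⟩ | ⟨-, rfl⟩
      · exact Or.inr mem_branch_self
      · exact Or.inl mem_branch_self
    · rcases ih with ih | ih
      · exact Or.inl (branch_step ih hadj hne)
      · exact Or.inr (branch_step ih hadj (by rwa [Sym2.eq_swap (a := v)]))

theorem branch_disjoint (hT : T.IsAcyclic) (huv : T.Adj u v) (hx : x ∈ T.branch u v) :
    x ∉ T.branch v u := by
  intro hx'
  have hb := isAcyclic_iff_forall_adj_isBridge.1 hT huv
  rw [isBridge_iff] at hb
  have h' : (T.deleteEdges {s(u, v)}).Reachable v x := by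
    have := hx'
    unfold branch at this
    rwa [Set.mem_ofPred_eq, Sym2.eq_swap] at this
  exact hb (hx.trans h'.symm)

theorem ne_of_mem_branch (hT : T.IsAcyclic) (hwu : T.Adj w u) (hx : x ∈ T.branch w u) :
    x ≠ u := by
  rintro rfl
  exact branch_disjoint hT hwu hx mem_branch_self

theorem branch_subset (hT : T.IsAcyclic) (hwu : T.Adj w u) (hwv : w ≠ v) :
    T.branch w u ⊆ T.branch u v := by
  intro x hx
  refine branch_induction (motive := fun x => x ∈ T.branch u v) ?_ ?_ hx
  · exact branch_step mem_branch_self hwu.symm (by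
      intro h
      rcases Sym2.eq_iff.1 h with ⟨-, h⟩ | ⟨-, h⟩
      · exact hwv h
      · exact hwu.ne h)
  · intro x y hx hxy hne ih
    have hy := branch_step hx hxy hne
    refine branch_step ih hxy fun h => ?_
    rcases Sym2.eq_iff.1 h with ⟨h, -⟩ | ⟨-, h⟩
    · exact ne_of_mem_branch hT hwu hx h
    · exact ne_of_mem_branch hT hwu hy h

theorem exists_branch_of_mem (hT : T.IsAcyclic) (hx : x ∈ T.branch u v) :
    x = u ∨ ∃ w, T.Adj w u ∧ w ≠ v ∧ x ∈ T.branch w u := by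
  refine branch_induction
    (motive := fun x => x = u ∨ ∃ w, T.Adj w u ∧ w ≠ v ∧ x ∈ T.branch w u) (Or.inl rfl) ?_ hx
  rintro x y - hxy hne (rfl | ⟨w, hwu, hwv, hx⟩)
  · refine Or.inr ⟨y, hxy.symm, ?_, mem_branch_self⟩
    rintro rfl
    exact hne rfl
  · by_cases hy : y = u
    · exact Or.inl hy
    · refine Or.inr ⟨w, hwu, hwv, branch_step hx hxy fun h => ?_⟩
      rcases Sym2.eq_iff.1 h with ⟨-, h⟩ | ⟨h, -⟩
      · exact hy h
      · exact ne_of_mem_branch hT hwu hx h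

theorem branch_disjoint_branch (hT : T.IsAcyclic) {w' : N} (hwu : T.Adj w u) (hwu' : T.Adj w' u)
    (hne : w ≠ w') : Disjoint (T.branch w u) (T.branch w' u) := by
  rw [Set.disjoint_left]
  intro x hx
  exact branch_disjoint hT hwu'.symm (branch_subset hT hwu hne hx)

end branch

end SimpleGraph

/-! ### From decomposition trees to binary decompositions. -/

namespace DecompositionTree

variable {V : Type*} (D : DecompositionTree V)

open SimpleGraph

theorem mem_side {u v : D.Node} {x : V} :
    x ∈ D.side u v ↔ (D.leafEquiv x : D.Node) ∈ D.tree.branch u v := Iff.rfl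

theorem side_union_side (u v : D.Node) : D.side u v ∪ D.side v u = Set.univ :=
  Set.eq_univ_of_forall fun _ => branch_total D.isTree.connected _

theorem disjoint_side_side {u v : D.Node} (h : D.tree.Adj u v) :
    Disjoint (D.side u v) (D.side v u) :=
  Set.disjoint_left.2 fun _ hx => branch_disjoint D.isTree.isAcyclic h hx

/-- Induction on the number of nodes on the side of `u`. If `u` is a leaf, the side is a singleton;
otherwise `u` carries no vertex, and the side is the disjoint union of the smaller sides at the two
other neighbours of `u`. -/
theorem binaryDecomp_side {P : Set V → Prop} (hP : ∀ u v, D.tree.Adj u v → P (D.side u v))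
    {u v : D.Node} (huv : D.tree.Adj u v) : BinaryDecomp P (D.side u v) := by
  have := D.finite_node
  have hT := D.isTree.isAcyclic
  induction hn : (D.tree.branch u v).ncard using Nat.strong_induction_on generalizing u v with
  | _ n ih =>
  have hlt : ∀ w, D.tree.Adj w u → w ≠ v → (D.tree.branch w u).ncard < n := by
    intro w hwu hwv
    rw [← hn]
    exact Set.ncard_lt_ncard ⟨branch_subset hT hwu hwv,
      fun h => ne_of_mem_branch hT hwu (h mem_branch_self) rfl⟩
  rcases D.subcubic u with hu | hu
  · have hnb : ∀ w, D.tree.Adj w u → w = v := fun w hw =>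
      (Set.ncard_le_one (Set.toFinite _)).1 hu _ hw.symm _ huv
    have hs : D.side u v = {D.leafEquiv.symm ⟨u, hu⟩} := by
      ext x
      rw [mem_side, Set.mem_singleton_iff, Equiv.eq_symm_apply, Subtype.ext_iff]
      constructor
      · intro hx
        rcases exists_branch_of_mem hT hx with h | ⟨w, hw, hwv, -⟩
        · exact h
        · exact (hwv (hnb w hw)).elim
      · intro h
        rw [h]
        exact mem_branch_self
    rw [hs]
    exact .single _ (hs ▸ hP u v huv)
  · have h2 : (D.tree.neighborSet u \ {v}).ncard = 2 := by
      rw [Set.ncard_sdiff_singleton_of_mem ((mem_neighborSet _ _ _).2 huv), hu]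
    obtain ⟨w, w', hne, hww⟩ := Set.ncard_eq_two.1 h2
    have hmem : ∀ z, (D.tree.Adj z u ∧ z ≠ v) ↔ z = w ∨ z = w' := by
      intro z
      have : z ∈ D.tree.neighborSet u \ {v} ↔ z ∈ ({w, w'} : Set D.Node) := by rw [hww]
      simpa [adj_comm] using this
    obtain ⟨hw, hwv⟩ := (hmem w).2 (Or.inl rfl)
    obtain ⟨hw', hwv'⟩ := (hmem w').2 (Or.inr rfl)
    have hs : D.side u v = D.side w u ∪ D.side w' u := by
      ext x
      rw [Set.mem_union, mem_side, mem_side, mem_side]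
      constructor
      · intro hx
        rcases exists_branch_of_mem hT hx with h | ⟨z, hz, hzv, hx⟩
        · have := (D.leafEquiv x).2
          rw [h, hu] at this
          omega
        · rcases (hmem z).1 ⟨hz, hzv⟩ with rfl | rfl
          · exact Or.inl hx
          · exact Or.inr hx
      · rintro (h | h)
        · exact branch_subset hT hw hwv h
        · exact branch_subset hT hw' hwv' h
    rw [hs]
    refine .union ?_ (ih _ (hlt w hw hwv) hw rfl) (ih _ (hlt w' hw' hwv') hw' rfl)
      (hs ▸ hP u v huv)
    exact Set.disjoint_left.2 fun x hx hx' =>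
      Set.disjoint_left.1 (branch_disjoint_branch hT hw hw' hne) hx hx'

/-- Any edge splits the vertex set into its two sides; a tree without edges carries a single vertex.
The full set is not a side of an edge, so `P` is assumed for it separately. -/
theorem binaryDecomp_univ [Nonempty V] {P : Set V → Prop}
    (hP : ∀ u v, D.tree.Adj u v → P (D.side u v)) (huniv : P Set.univ) :
    BinaryDecomp P Set.univ := by
  by_cases h : ∃ u v, D.tree.Adj u v
  · obtain ⟨u, v, huv⟩ := h
    have hu := D.side_union_side u v
    rw [← hu] at huniv ⊢
    exact .union (D.disjoint_side_side huv) (D.binaryDecomp_side hP huv)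
      (D.binaryDecomp_side hP huv.symm) huniv
  · push Not at h
    obtain ⟨x⟩ := ‹Nonempty V›
    have hx : (Set.univ : Set V) = {x} := by
      refine (Set.eq_univ_of_forall fun y => ?_).symm
      have hr := (reachable_iff_reflTransGen _ _).1
        (D.isTree.connected.preconnected (D.leafEquiv y : D.Node) (D.leafEquiv x))
      rcases hr.cases_head with hr | ⟨z, hz, -⟩
      · exact D.leafEquiv.injective (Subtype.ext hr)
      · exact (h _ _ hz).elim
    rw [hx] at huniv ⊢
    exact .single x huniv

theorem le_width (f : Set V → ℝ) {u v : D.Node} (h : D.tree.Adj u v) :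
    f (D.side u v) ≤ D.width f := by
  have := D.finite_node
  refine le_csSup (Set.Finite.bddAbove ?_) ⟨u, v, h, rfl⟩
  refine (Set.finite_range fun p : D.Node × D.Node => f (D.side p.1 p.2)).subset ?_
  rintro r ⟨u, v, -, rfl⟩
  exact ⟨(u, v), rfl⟩

theorem width_nonneg {f : Set V → ℝ} (hf : ∀ S, 0 ≤ f S) : 0 ≤ D.width f :=
  Real.sSup_nonneg (by rintro r ⟨u, v, -, rfl⟩; exact hf _)

theorem width_le {f : Set V → ℝ} {c : ℝ} (hc : 0 ≤ c)
    (h : ∀ u v, D.tree.Adj u v → f (D.side u v) ≤ c) : D.width f ≤ c :=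
  Real.sSup_le (by rintro r ⟨u, v, huv, rfl⟩; exact h u v huv) hc

end DecompositionTree

/-! ### Rooted binary trees from binary decompositions. -/

/-- A rooted binary tree whose nodes carry subsets of `A`, each set being either a singleton (at
a leaf) or the union of the sets of the two children. -/
structure LeafTree {V : Type*} (P : Set V → Prop) (A : Set V) where
  N : Type
  finite : Finite N
  par : N → Option N
  root : N
  height : N → ℕ
  val : N → Set V
  lab : V → N
  par_eq_none : ∀ x, par x = none ↔ x = root
  height_lt : ∀ {x y}, par x = some y → height x < height y
  descends_root : ∀ x, Relation.ReflTransGen (fun a b => par a = some b) x root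
  val_root : val root = A
  lab_injOn : Set.InjOn lab A
  holds : ∀ x, P (val x)
  children : ∀ x, ((∀ c, par c ≠ some x) ∧ ∃ v ∈ A, val x = {v} ∧ lab v = x) ∨
    ∃ c d, c ≠ d ∧ (∀ e, par e = some x ↔ e = c ∨ e = d) ∧ val x = val c ∪ val d
  par_ne_lab : ∀ v ∈ A, ∀ c, par c ≠ some (lab v)
  mem_val_lab : ∀ v ∈ A, v ∈ val (lab v)

namespace LeafTree

variable {V : Type*} {P : Set V → Prop} {A B : Set V}

/-- The one-node tree. -/
def single (v : V) (h : P {v}) : LeafTree P {v} where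
  N := Unit
  finite := inferInstance
  par _ := none
  root := ()
  height _ := 0
  val _ := {v}
  lab _ := ()
  par_eq_none _ := by simp
  height_lt h := by simp at h
  descends_root _ := .refl
  val_root := rfl
  lab_injOn := by simp
  holds _ := h
  children _ := Or.inl ⟨by simp, v, rfl, rfl, rfl⟩
  par_ne_lab := by simp
  mem_val_lab _ h := h

open Classical in
/-- The tree with a new root whose children are the roots of the two given trees. -/
def join (hd : Disjoint A B) (S : LeafTree P A) (T : LeafTree P B) (h : P (A ∪ B)) :
    LeafTree P (A ∪ B) where
  N := Option (S.N ⊕ T.N)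
  finite := by
    have := S.finite
    have := T.finite
    infer_instance
  par
    | none => none
    | some (.inl x) => some ((S.par x).map .inl)
    | some (.inr x) => some ((T.par x).map .inr)
  root := none
  height
    | none => S.height S.root + T.height T.root + 1
    | some (.inl x) => S.height x
    | some (.inr x) => T.height x
  val
    | none => A ∪ B
    | some (.inl x) => S.val x
    | some (.inr x) => T.val x
  lab v := if v ∈ A then some (.inl (S.lab v)) else some (.inr (T.lab v))
  par_eq_none := by rintro (_ | x | x) <;> simp
  height_lt := by
    rintro (_ | x | x) y h
    · simp at h
    · rcases hx : S.par x with _ | z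
      · have := (S.par_eq_none x).1 hx
        simp [hx] at h
        subst h this
        simp
      · simp [hx] at h
        subst h
        exact S.height_lt hx
    · rcases hx : T.par x with _ | z
      · have := (T.par_eq_none x).1 hx
        simp [hx] at h
        subst h this
        simp
      · simp [hx] at h
        subst h
        exact T.height_lt hx
  descends_root := by
    rintro (_ | x | x)
    · exact .refl
    · refine .tail (Relation.ReflTransGen.lift (fun z => some (Sum.inl z)) ?_ _ _ (S.descends_root x)) ?_
      · intro a b h
        change some ((S.par a).map Sum.inl) = _
        rw [h]
        rfl
      · simp [(S.par_eq_none S.root).2 rfl]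
    · refine .tail (Relation.ReflTransGen.lift (fun z => some (Sum.inr z)) ?_ _ _ (T.descends_root x)) ?_
      · intro a b h
        change some ((T.par a).map Sum.inr) = _
        rw [h]
        rfl
      · simp [(T.par_eq_none T.root).2 rfl]
  val_root := rfl
  lab_injOn := by
    intro v hv w hw h
    by_cases h1 : v ∈ A <;> by_cases h2 : w ∈ A <;> simp [h1, h2] at h
    · exact S.lab_injOn h1 h2 h
    · exact T.lab_injOn (hv.resolve_left h1) (hw.resolve_left h2) h
  holds := by
    rintro (_ | x | x)
    · exact h
    · exact S.holds x
    · exact T.holds x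
  children := by
    rintro (_ | x | x)
    · refine Or.inr ⟨some (.inl S.root), some (.inr T.root), by simp, ?_, ?_⟩
      · rintro (_ | y | y)
        · simp
        · simp [S.par_eq_none]
        · simp [T.par_eq_none]
      · simp [S.val_root, T.val_root]
    · rcases S.children x with ⟨hc, v, hv, hx, hl⟩ | ⟨c, d, hcd, he, hx⟩
      · refine Or.inl ⟨?_, v, Or.inl hv, hx, by simp [hv, hl]⟩
        rintro (_ | y | y) <;> simp [hc]
      · refine Or.inr ⟨some (.inl c), some (.inl d), by simpa using hcd, ?_, hx⟩
        rintro (_ | y | y) <;> simp [he]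
    · rcases T.children x with ⟨hc, v, hv, hx, hl⟩ | ⟨c, d, hcd, he, hx⟩
      · refine Or.inl ⟨?_, v, Or.inr hv, hx, by simp [hd.notMem_of_mem_right hv, hl]⟩
        rintro (_ | y | y) <;> simp [hc]
      · refine Or.inr ⟨some (.inr c), some (.inr d), by simpa using hcd, ?_, hx⟩
        rintro (_ | y | y) <;> simp [he]
  par_ne_lab := by
    intro v hv
    by_cases h1 : v ∈ A
    · rintro (_ | y | y) <;> simp [h1, S.par_ne_lab v h1]
    · rintro (_ | y | y) <;> simp [h1, T.par_ne_lab v (hv.resolve_left h1)]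
  mem_val_lab := by
    intro v hv
    by_cases h1 : v ∈ A
    · simpa [h1] using S.mem_val_lab v h1
    · simpa [h1] using T.mem_val_lab v (hv.resolve_left h1)

theorem nonempty_of_binaryDecomp (h : BinaryDecomp P A) : Nonempty (LeafTree P A) := by
  induction h with
  | single v h => exact ⟨single v h⟩
  | union hd _ _ h ihA ihB => exact ⟨join hd ihA.some ihB.some h⟩

variable (T : LeafTree P A)

/-- `T.Desc x y`: the node `x` is a descendant of `y`. -/
def Desc : T.N → T.N → Prop := Relation.ReflTransGen fun a b => T.par a = some b

variable {T} {x y z : T.N}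

theorem Desc.height_le (h : T.Desc x y) : T.height x ≤ T.height y := by
  induction h with
  | refl => exact le_rfl
  | tail _ h ih => exact ih.trans (T.height_lt h).le

theorem val_subset_of_par (h : T.par x = some y) : T.val x ⊆ T.val y := by
  rcases T.children y with ⟨hc, -⟩ | ⟨c, d, -, he, hy⟩
  · exact (hc _ h).elim
  · rw [hy]
    rcases (he x).1 h with rfl | rfl
    · exact Set.subset_union_left
    · exact Set.subset_union_right

theorem Desc.val_subset (h : T.Desc x y) : T.val x ⊆ T.val y := by
  induction h with
  | refl => exact subset_rfl
  | tail _ h ih => exact ih.trans (val_subset_of_par h)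

theorem desc_lab_of_mem {v : V} (h : v ∈ T.val x) : T.Desc (T.lab v) x := by
  induction hn : T.height x using Nat.strong_induction_on generalizing x with
  | _ n ih =>
  rcases T.children x with ⟨-, w, -, hx, hl⟩ | ⟨c, d, -, he, hx⟩
  · rw [hx, Set.mem_singleton_iff] at h
    subst h
    rw [hl]
    exact .refl
  · rw [hx] at h
    have hc := (he c).2 (Or.inl rfl)
    have hd := (he d).2 (Or.inr rfl)
    rcases h with h | h
    · exact .tail (ih _ (hn ▸ T.height_lt hc) h rfl) hc
    · exact .tail (ih _ (hn ▸ T.height_lt hd) h rfl) hd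

theorem mem_val_iff {v : V} (hv : v ∈ A) : v ∈ T.val x ↔ T.Desc (T.lab v) x :=
  ⟨desc_lab_of_mem, fun h => h.val_subset (T.mem_val_lab v hv)⟩

theorem val_subset : T.val x ⊆ A := by
  have := Desc.val_subset (T.descends_root x)
  rwa [T.val_root] at this

theorem desc_root_left (h : T.Desc T.root x) : x = T.root := by
  rcases h.cases_head with h | ⟨y, hy, -⟩
  · exact h.symm
  · rw [(T.par_eq_none _).2 rfl] at hy
    simp at hy

end LeafTree

/-! ### Trees described by a parent function. -/

namespace SimpleGraph

/-- The graph that joins every `x` to `up x`. -/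
def ofUp {N : Type*} (up : N → N) : SimpleGraph N := fromRel fun x y => up x = y

section ofUp

variable {N : Type*} {up : N → N} {B : N → Set N}

/-- `B x` behaves as the set of descendants of `x` with respect to the parent function `up`, the
root being replaced by a pair of nodes that `up` interchanges. -/
structure IsUpFamily (up : N → N) (B : N → Set N) : Prop where
  self_mem : ∀ x, x ∈ B x
  up_notMem : ∀ x, up x ∉ B x
  up_mem : ∀ x y, y ∈ B x → y ≠ x → up y ∈ B x
  mem_of_up_mem : ∀ x z, up z ∈ B x → z ∈ B x ∨ (z = up x ∧ up z = x)

namespace IsUpFamily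

variable (h : IsUpFamily up B)

include h

theorem up_ne (x : N) : up x ≠ x := fun hx => h.up_notMem x (hx.symm ▸ h.self_mem x)

theorem adj_iff {x y : N} : (ofUp up).Adj x y ↔ up x = y ∨ up y = x := by
  rw [ofUp, fromRel_adj]
  refine ⟨fun h => h.2, fun h' => ⟨?_, h'⟩⟩
  rintro rfl
  exact h.up_ne x (by simpa using h')

/-- The edge between `x` and `up x` is the only one that leaves `B x`. Hence `B x` and its
complement are the two sides of that edge, and every edge is a bridge. -/
theorem mem_of_adj {x y z : N} (hyz : (ofUp up).Adj y z) (hne : s(y, z) ≠ s(x, up x))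
    (hy : y ∈ B x) : z ∈ B x := by
  rcases h.adj_iff.1 hyz with rfl | rfl
  · refine h.up_mem x y hy ?_
    rintro rfl
    exact hne rfl
  · rcases h.mem_of_up_mem x z hy with h | ⟨rfl, h⟩
    · exact h
    · rw [h] at hne
      exact (hne rfl).elim

theorem branch_subset (x : N) : (ofUp up).branch x (up x) ⊆ B x := by
  intro y hy
  refine branch_induction (motive := fun y => y ∈ B x) (h.self_mem x) ?_ hy
  intro a b _ hab hne ha
  exact h.mem_of_adj hab hne ha

theorem branch_subset_compl (x : N) : (ofUp up).branch (up x) x ⊆ (B x)ᶜ := by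
  intro y hy
  refine branch_induction (motive := fun y => y ∉ B x) (h.up_notMem x) ?_ hy
  intro a b _ hab hne ha hb
  exact ha (h.mem_of_adj hab.symm (by rwa [Sym2.eq_swap (a := b), Sym2.eq_swap (a := x)]) hb)

theorem isAcyclic : (ofUp up).IsAcyclic := by
  have key : ∀ x, (ofUp up).IsBridge s(x, up x) := by
    intro x
    rw [isBridge_iff]
    intro hr
    exact h.up_notMem x (h.branch_subset x hr)
  rw [isAcyclic_iff_forall_adj_isBridge]
  intro x y hxy
  rcases h.adj_iff.1 hxy with rfl | rfl
  · exact key x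
  · rw [Sym2.eq_swap]
    exact key y

theorem branch_eq (hconn : (ofUp up).Connected) (x : N) :
    (ofUp up).branch x (up x) = B x := by
  refine (h.branch_subset x).antisymm fun y hy => ?_
  rcases branch_total hconn (u := x) (v := up x) y with hb | hb
  · exact hb
  · exact (h.branch_subset_compl x hb hy).elim

theorem branch_up_eq (hconn : (ofUp up).Connected) (x : N) :
    (ofUp up).branch (up x) x = (B x)ᶜ := by
  refine (h.branch_subset_compl x).antisymm fun y hy => ?_
  rcases branch_total hconn (u := x) (v := up x) y with hb | hb
  · exact (hy (h.branch_subset x hb)).elim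
  · exact hb

end IsUpFamily

end ofUp
end SimpleGraph

/-! ### Gluing two rooted trees into a decomposition tree. -/

namespace LeafTree

open SimpleGraph

variable {V : Type*} {P : Set V → Prop} {A B : Set V} (S : LeafTree P A) (T : LeafTree P B)

/-- The parent function of two rooted trees whose roots are joined by an edge. -/
def glueUp : S.N ⊕ T.N → S.N ⊕ T.N
  | .inl x => (S.par x).elim (.inr T.root) .inl
  | .inr x => (T.par x).elim (.inl S.root) .inr

/-- The descendants of a node in the disjoint union of two rooted trees. -/
def glueBelow : S.N ⊕ T.N → Set (S.N ⊕ T.N)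
  | .inl x => Sum.inl '' {y | S.Desc y x}
  | .inr x => Sum.inr '' {y | T.Desc y x}

/-- The set carried by a node in the disjoint union of two rooted trees. -/
def glueVal : S.N ⊕ T.N → Set V := Sum.elim S.val T.val

variable {S T}

theorem glueUp_inl_of_par {x y : S.N} (h : S.par x = some y) : glueUp S T (.inl x) = .inl y := by
  simp [glueUp, h]

theorem glueUp_inr_of_par {x y : T.N} (h : T.par x = some y) : glueUp S T (.inr x) = .inr y := by
  simp [glueUp, h]

theorem glueUp_inl_root : glueUp S T (.inl S.root) = .inr T.root := by
  simp [glueUp, (S.par_eq_none _).2 rfl]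

theorem glueUp_inr_root : glueUp S T (.inr T.root) = .inl S.root := by
  simp [glueUp, (T.par_eq_none _).2 rfl]

theorem eq_root_or_par {P : Set V → Prop} {A : Set V} {S : LeafTree P A} (x : S.N) :
    x = S.root ∨ ∃ y, S.par x = some y := by
  rcases h : S.par x with _ | y
  · exact Or.inl ((S.par_eq_none x).1 h)
  · exact Or.inr ⟨y, rfl⟩

theorem not_desc_par {x y : S.N} (h : S.par x = some y) : ¬ S.Desc y x := fun h' =>
  absurd h'.height_le (S.height_lt h).not_ge

theorem isUpFamily_glue : IsUpFamily (glueUp S T) (glueBelow S T) where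
  self_mem := by
    rintro (x | x)
    · exact ⟨x, .refl, rfl⟩
    · exact ⟨x, .refl, rfl⟩
  up_notMem := by
    rintro (x | x) h
    · rcases eq_root_or_par x with rfl | ⟨y, hy⟩
      · rw [glueUp_inl_root] at h
        simp [glueBelow] at h
      · rw [glueUp_inl_of_par hy] at h
        simp [glueBelow, not_desc_par hy] at h
    · rcases eq_root_or_par x with rfl | ⟨y, hy⟩
      · rw [glueUp_inr_root] at h
        simp [glueBelow] at h
      · rw [glueUp_inr_of_par hy] at h
        simp [glueBelow, not_desc_par hy] at h
  up_mem := by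
    rintro (x | x) _ ⟨y, hy, rfl⟩ hne
    · rcases hy.cases_head with rfl | ⟨z, hz, hzx⟩
      · exact (hne rfl).elim
      · rw [glueUp_inl_of_par hz]
        exact ⟨z, hzx, rfl⟩
    · rcases hy.cases_head with rfl | ⟨z, hz, hzx⟩
      · exact (hne rfl).elim
      · rw [glueUp_inr_of_par hz]
        exact ⟨z, hzx, rfl⟩
  mem_of_up_mem := by
    rintro (x | x) (z | z) h
    · rcases eq_root_or_par z with rfl | ⟨y, hy⟩
      · rw [glueUp_inl_root] at h
        simp [glueBelow] at h
      · rw [glueUp_inl_of_par hy] at h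
        obtain ⟨w, hw, hwy⟩ := h
        cases hwy
        exact Or.inl ⟨z, .head hy hw, rfl⟩
    · rcases eq_root_or_par z with rfl | ⟨y, hy⟩
      · rw [glueUp_inr_root] at h
        obtain ⟨w, hw, hwy⟩ := h
        cases hwy
        obtain rfl := desc_root_left hw
        exact Or.inr ⟨glueUp_inl_root.symm, glueUp_inr_root⟩
      · rw [glueUp_inr_of_par hy] at h
        simp [glueBelow] at h
    · rcases eq_root_or_par z with rfl | ⟨y, hy⟩
      · rw [glueUp_inl_root] at h
        obtain ⟨w, hw, hwy⟩ := h
        cases hwy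
        obtain rfl := desc_root_left hw
        exact Or.inr ⟨glueUp_inr_root.symm, glueUp_inl_root⟩
      · rw [glueUp_inl_of_par hy] at h
        simp [glueBelow] at h
    · rcases eq_root_or_par z with rfl | ⟨y, hy⟩
      · rw [glueUp_inr_root] at h
        simp [glueBelow] at h
      · rw [glueUp_inr_of_par hy] at h
        obtain ⟨w, hw, hwy⟩ := h
        cases hwy
        exact Or.inl ⟨z, .head hy hw, rfl⟩

theorem connected_glue : (ofUp (glueUp S T)).Connected := by
  have hadj : ∀ x, (ofUp (glueUp S T)).Adj x (glueUp S T x) := fun x =>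
    isUpFamily_glue.adj_iff.2 (Or.inl rfl)
  rw [connected_iff_exists_forall_reachable]
  refine ⟨.inl S.root, ?_⟩
  rintro (x | x)
  · refine Reachable.symm ((reachable_iff_reflTransGen _ _).2 ?_)
    refine Relation.ReflTransGen.lift Sum.inl ?_ _ _ (S.descends_root x)
    intro a b h
    have := hadj (.inl a)
    rwa [glueUp_inl_of_par h] at this
  · have h1 : (ofUp (glueUp S T)).Adj (.inr T.root) (.inl S.root) := by
      have := hadj (.inr T.root)
      rwa [glueUp_inr_root] at this
    refine Reachable.symm (Reachable.trans ((reachable_iff_reflTransGen _ _).2 ?_) h1.reachable)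
    refine Relation.ReflTransGen.lift Sum.inr ?_ _ _ (T.descends_root x)
    intro a b h
    have := hadj (.inr a)
    rwa [glueUp_inr_of_par h] at this

theorem glueUp_eq_inl_iff {x : S.N} {y : S.N ⊕ T.N} :
    glueUp S T y = .inl x ↔ (∃ c, S.par c = some x ∧ y = .inl c) ∨
      (x = S.root ∧ y = .inr T.root) := by
  rcases y with y | y
  · rcases eq_root_or_par y with rfl | ⟨z, hz⟩
    · simp [glueUp_inl_root, (S.par_eq_none _).2 rfl]
    · simp [glueUp_inl_of_par hz, hz]
  · rcases eq_root_or_par y with rfl | ⟨z, hz⟩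
    · simp [glueUp_inr_root, eq_comm]
    · have : y ≠ T.root := fun h => by simp [(T.par_eq_none y).2 h] at hz
      simp [glueUp_inr_of_par hz, this]

theorem glueUp_eq_inr_iff {x : T.N} {y : S.N ⊕ T.N} :
    glueUp S T y = .inr x ↔ (∃ c, T.par c = some x ∧ y = .inr c) ∨
      (x = T.root ∧ y = .inl S.root) := by
  rcases y with y | y
  · rcases eq_root_or_par y with rfl | ⟨z, hz⟩
    · simp [glueUp_inl_root, eq_comm]
    · have : y ≠ S.root := fun h => by simp [(S.par_eq_none y).2 h] at hz
      simp [glueUp_inl_of_par hz, this]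
  · rcases eq_root_or_par y with rfl | ⟨z, hz⟩
    · simp [glueUp_inr_root, (T.par_eq_none _).2 rfl]
    · simp [glueUp_inr_of_par hz, hz]

theorem ncard_children (x : S.N) : {c | S.par c = some x}.ncard = 2 ∨
    (∀ c, S.par c ≠ some x) ∧ {c | S.par c = some x}.ncard = 0 := by
  rcases S.children x with ⟨hc, -⟩ | ⟨c, d, hcd, he, -⟩
  · refine Or.inr ⟨hc, ?_⟩
    have : {c | S.par c = some x} = ∅ := Set.eq_empty_of_forall_notMem hc
    rw [this, Set.ncard_empty]
  · refine Or.inl ?_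
    have : {c | S.par c = some x} = {c, d} := Set.ext he
    rw [this, Set.ncard_pair hcd]

theorem ncard_neighborSet_inl (x : S.N) :
    ((ofUp (glueUp S T)).neighborSet (.inl x)).ncard = {c | S.par c = some x}.ncard + 1 := by
  have := S.finite
  have h : (ofUp (glueUp S T)).neighborSet (.inl x) =
      insert (glueUp S T (.inl x)) (Sum.inl '' {c | S.par c = some x}) := by
    ext y
    rw [mem_neighborSet, isUpFamily_glue.adj_iff, glueUp_eq_inl_iff, Set.mem_insert_iff]
    constructor
    · rintro (h | ⟨c, hc, rfl⟩ | ⟨rfl, rfl⟩)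
      · exact Or.inl h.symm
      · exact Or.inr ⟨c, hc, rfl⟩
      · exact Or.inl glueUp_inl_root.symm
    · rintro (h | ⟨c, hc, rfl⟩)
      · exact Or.inl h.symm
      · exact Or.inr (Or.inl ⟨c, hc, rfl⟩)
  rw [h, Set.ncard_insert_of_notMem, Set.ncard_image_of_injective _ Sum.inl_injective]
  rintro ⟨c, hc, hx⟩
  rcases glueUp_eq_inl_iff.1 hx.symm with ⟨d, hd, hdx⟩ | ⟨-, h⟩
  · cases hdx
    exact absurd (S.height_lt hd) (S.height_lt hc).not_gt
  · cases h

theorem ncard_neighborSet_inr (x : T.N) :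
    ((ofUp (glueUp S T)).neighborSet (.inr x)).ncard = {c | T.par c = some x}.ncard + 1 := by
  have := T.finite
  have h : (ofUp (glueUp S T)).neighborSet (.inr x) =
      insert (glueUp S T (.inr x)) (Sum.inr '' {c | T.par c = some x}) := by
    ext y
    rw [mem_neighborSet, isUpFamily_glue.adj_iff, glueUp_eq_inr_iff, Set.mem_insert_iff]
    constructor
    · rintro (h | ⟨c, hc, rfl⟩ | ⟨rfl, rfl⟩)
      · exact Or.inl h.symm
      · exact Or.inr ⟨c, hc, rfl⟩
      · exact Or.inl glueUp_inr_root.symm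
    · rintro (h | ⟨c, hc, rfl⟩)
      · exact Or.inl h.symm
      · exact Or.inr (Or.inl ⟨c, hc, rfl⟩)
  rw [h, Set.ncard_insert_of_notMem, Set.ncard_image_of_injective _ Sum.inr_injective]
  rintro ⟨c, hc, hx⟩
  rcases glueUp_eq_inr_iff.1 hx.symm with ⟨d, hd, hdx⟩ | ⟨-, h⟩
  · cases hdx
    exact absurd (T.height_lt hd) (T.height_lt hc).not_gt
  · cases h

theorem ncard_neighborSet_lab {v : V} (hv : v ∈ A) :
    ((ofUp (glueUp S T)).neighborSet (.inl (S.lab v))).ncard ≤ 1 := by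
  rw [ncard_neighborSet_inl]
  have : {c | S.par c = some (S.lab v)} = ∅ := Set.eq_empty_of_forall_notMem (S.par_ne_lab v hv)
  rw [this, Set.ncard_empty]

theorem ncard_neighborSet_lab' {v : V} (hv : v ∈ B) :
    ((ofUp (glueUp S T)).neighborSet (.inr (T.lab v))).ncard ≤ 1 := by
  rw [ncard_neighborSet_inr]
  have : {c | T.par c = some (T.lab v)} = ∅ := Set.eq_empty_of_forall_notMem (T.par_ne_lab v hv)
  rw [this, Set.ncard_empty]

theorem exists_lab_eq {x : S.N} (h : {c | S.par c = some x}.ncard + 1 ≤ 1) :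
    ∃ v ∈ A, S.lab v = x := by
  rcases S.children x with ⟨-, v, hv, -, hx⟩ | ⟨c, d, hcd, he, -⟩
  · exact ⟨v, hv, hx⟩
  · have : {c | S.par c = some x} = {c, d} := Set.ext he
    rw [this, Set.ncard_pair hcd] at h
    omega

variable (S T) in
open Classical in
/-- The leaf that carries a vertex when two rooted trees are joined. -/
def glueLab (v : V) : S.N ⊕ T.N := if v ∈ A then .inl (S.lab v) else .inr (T.lab v)

theorem glueLab_mem_iff (hd : Disjoint A B) (hAB : A ∪ B = Set.univ) {v : V} {x : S.N ⊕ T.N} :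
    glueLab S T v ∈ glueBelow S T x ↔ v ∈ glueVal S T x := by
  have hB : v ∉ A → v ∈ B := fun h => (hAB.symm ▸ Set.mem_univ v : v ∈ A ∪ B).resolve_left h
  by_cases h : v ∈ A <;> rcases x with x | x
  · simp [glueLab, h, glueBelow, glueVal, mem_val_iff]
  · simp only [glueLab, h, glueBelow, glueVal]
    simp only [if_true, Sum.elim_inr]
    simpa using fun hv : v ∈ T.val x => hd.notMem_of_mem_left h (val_subset hv)
  · simp only [glueLab, h, glueBelow, glueVal]
    simp only [if_false, Sum.elim_inl]
    simpa using fun hv : v ∈ S.val x => h (val_subset hv)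
  · simp [glueLab, h, glueBelow, glueVal, mem_val_iff (hB h)]

/-- The decomposition tree that arises by joining the roots of two rooted trees. -/
def glue (S : LeafTree P A) (T : LeafTree P B) (hd : Disjoint A B) (hAB : A ∪ B = Set.univ) :
    DecompositionTree V where
  Node := S.N ⊕ T.N
  finite_node := by
    have := S.finite
    have := T.finite
    infer_instance
  tree := ofUp (glueUp S T)
  isTree := ⟨connected_glue, isUpFamily_glue.isAcyclic⟩
  subcubic := by
    rintro (x | x)
    · rw [ncard_neighborSet_inl]
      rcases ncard_children x with h | ⟨-, h⟩ <;> simp [h]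
    · rw [ncard_neighborSet_inr]
      rcases ncard_children x with h | ⟨-, h⟩ <;> simp [h]
  leafEquiv := by
    have hB : ∀ v, v ∉ A → v ∈ B := fun v h =>
      (hAB.symm ▸ Set.mem_univ v : v ∈ A ∪ B).resolve_left h
    refine Equiv.ofBijective (fun v => ⟨glueLab S T v, ?_⟩) ⟨?_, ?_⟩
    · by_cases h : v ∈ A
      · simpa [glueLab, h] using ncard_neighborSet_lab h
      · simpa [glueLab, h] using ncard_neighborSet_lab' (hB v h)
    · intro v w h
      by_cases h1 : v ∈ A <;> by_cases h2 : w ∈ A <;>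
        simp [h1, h2, glueLab] at h
      · exact S.lab_injOn h1 h2 h
      · exact T.lab_injOn (hB v h1) (hB w h2) h
    · rintro ⟨x | x, hx⟩
      · rw [ncard_neighborSet_inl] at hx
        obtain ⟨v, hv, rfl⟩ := exists_lab_eq hx
        exact ⟨v, Subtype.ext (by simp [glueLab, hv])⟩
      · rw [ncard_neighborSet_inr] at hx
        obtain ⟨v, hv, rfl⟩ := exists_lab_eq hx
        exact ⟨v, Subtype.ext (by simp [glueLab, hd.notMem_of_mem_right hv])⟩

theorem side_glue (hd : Disjoint A B) (hAB : A ∪ B = Set.univ) (x : S.N ⊕ T.N) :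
    (glue S T hd hAB).side x (glueUp S T x) = glueVal S T x := by
  ext v
  have h := glueLab_mem_iff (S := S) (T := T) hd hAB (v := v) (x := x)
  rw [← isUpFamily_glue.branch_eq connected_glue] at h
  exact h

theorem compl_side_glue (hd : Disjoint A B) (hAB : A ∪ B = Set.univ) (x : S.N ⊕ T.N) :
    ((glue S T hd hAB).side (glueUp S T x) x)ᶜ = glueVal S T x := by
  ext v
  have h := (glueLab_mem_iff (S := S) (T := T) hd hAB (v := v) (x := x)).not
  rw [← Set.mem_compl_iff, ← isUpFamily_glue.branch_up_eq connected_glue] at h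
  exact (not_congr h).trans not_not

end LeafTree

namespace BinaryDecomp

variable {V : Type*} {P : Set V → Prop}

/-- The topmost union becomes an edge between the roots of the two parts, since a node for it would
have degree two. Every edge joins a node to its parent or to the other root; read in one direction
its side is the set of that node, in the other the complement. -/
theorem exists_decompositionTree (h : BinaryDecomp P Set.univ) :
    ∃ D : DecompositionTree V, ∀ u v, D.tree.Adj u v → P (D.side u v) ∨ P (D.side u v)ᶜ := by
  generalize hU : (Set.univ : Set V) = U at h
  cases h with
  | single v h =>
    have hv : ∀ w, w = v := fun w => by
      have := Set.mem_univ w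
      rwa [hU] at this
    refine ⟨{
      Node := Unit
      finite_node := inferInstance
      tree := ⊥
      isTree := SimpleGraph.IsTree.of_subsingleton
      subcubic := fun w => Or.inl ?_
      leafEquiv := Equiv.ofBijective (fun _ => ⟨(), ?_⟩) ⟨?_, ?_⟩ }, ?_⟩
    · simp
    · simp
    · intro a b _
      rw [hv a, hv b]
    · rintro ⟨⟨⟩, _⟩
      exact ⟨v, rfl⟩
    · rintro u w ⟨⟩
  | @union A B hd hA hB h =>
    obtain ⟨S⟩ := LeafTree.nonempty_of_binaryDecomp hA
    obtain ⟨T⟩ := LeafTree.nonempty_of_binaryDecomp hB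
    have hP : ∀ x, P (LeafTree.glueVal S T x) := by
      rintro (x | x)
      · exact S.holds x
      · exact T.holds x
    refine ⟨LeafTree.glue S T hd hU.symm, fun u v huv => ?_⟩
    rcases LeafTree.isUpFamily_glue.adj_iff.1 huv with rfl | rfl
    · exact Or.inl ((congrArg P (LeafTree.side_glue hd hU.symm u)).mpr (hP u))
    · exact Or.inr ((congrArg P (LeafTree.compl_side_glue hd hU.symm v)).mpr (hP v))

end BinaryDecomp

/-! ### Boolean cuts and classes of outer neighbourhoods. -/

namespace SimpleGraph

variable {V : Type*} (G : SimpleGraph V)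

theorem mem_unionNeighbors {Y : Set V} {z : V} : z ∈ G.unionNeighbors Y ↔ ∃ y ∈ Y, G.Adj y z := by
  simp [unionNeighbors]

/-- The sets of the form `N(Y) ∩ A` with `Y` disjoint from `A`. -/
def cutUnions (A : Set V) : Set (Set V) :=
  {X : Set V | X ⊆ A ∧ ∃ Y : Set V, Y ⊆ Aᶜ ∧ G.unionNeighbors Y \ Aᶜ = X}

theorem booleanCut_eq (A : Set V) : G.booleanCut A = Real.logb 2 ((G.cutUnions A).ncard : ℕ) := rfl

theorem mem_cutUnions {A X : Set V} :
    X ∈ G.cutUnions A ↔ ∃ Y : Set V, Y ⊆ Aᶜ ∧ ∀ z, z ∈ X ↔ z ∈ A ∧ ∃ y ∈ Y, G.Adj y z := by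
  constructor
  · rintro ⟨-, Y, hY, rfl⟩
    refine ⟨Y, hY, fun z => ?_⟩
    rw [Set.mem_sdiff, mem_unionNeighbors, Set.notMem_compl_iff, and_comm]
  · rintro ⟨Y, hY, hX⟩
    refine ⟨fun z hz => ((hX z).1 hz).1, Y, hY, ?_⟩
    ext z
    rw [hX, Set.mem_sdiff, mem_unionNeighbors, Set.notMem_compl_iff, and_comm]

/-- The number of different neighbourhoods outside `S` of the elements of `S`. -/
def outerClasses (S : Set V) : ℕ := ((fun x => G.neighborSet x \ S) '' S).ncard

variable [Finite V]

/-- A Galois correspondence: X = N(Y) ∩ A is sent to N(A \ X) \ A. No vertex of Y lies in N(A \ X),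
so X is recovered as the set of vertices of A with a neighbour outside both A and N(A \ X); the map
is injective. -/
theorem cutUnions_ncard_le_compl (A : Set V) :
    (G.cutUnions A).ncard ≤ (G.cutUnions Aᶜ).ncard := by
  have hrec : ∀ X ∈ G.cutUnions A, ∀ z, z ∈ X ↔
      z ∈ A ∧ ∃ y ∉ A, G.Adj y z ∧ ¬ ∃ w ∈ A \ X, G.Adj w y := by
    intro X hX z
    obtain ⟨Y, hY, hz⟩ := (G.mem_cutUnions).1 hX
    constructor
    · intro h
      obtain ⟨hA, y, hy, hyz⟩ := (hz z).1 h
      refine ⟨hA, y, hY hy, hyz, ?_⟩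
      rintro ⟨w, ⟨hwA, hwX⟩, hwy⟩
      exact hwX ((hz w).2 ⟨hwA, y, hy, hwy.symm⟩)
    · rintro ⟨hA, y, -, hyz, hn⟩
      by_contra h
      exact hn ⟨z, ⟨hA, h⟩, hyz.symm⟩
  refine Set.ncard_le_ncard_of_injOn (fun X => {y | y ∉ A ∧ ∃ w ∈ A \ X, G.Adj w y}) ?_ ?_
    (Set.toFinite _)
  · intro X _
    refine (G.mem_cutUnions).2 ⟨A \ X, ?_, fun z => Iff.rfl⟩
    rw [compl_compl]
    exact Set.sdiff_subset
  · intro X hX X' hX' h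
    have hy : ∀ y, y ∉ A → ((∃ w ∈ A \ X, G.Adj w y) ↔ ∃ w ∈ A \ X', G.Adj w y) := fun y hy => by
      have := Set.ext_iff.1 h y
      simpa [hy] using this
    ext z
    rw [hrec X hX, hrec X' hX']
    refine and_congr_right fun _ => exists_congr fun y => and_congr_right fun hyA => ?_
    rw [hy y hyA]

theorem cutUnions_ncard_compl (A : Set V) : (G.cutUnions Aᶜ).ncard = (G.cutUnions A).ncard := by
  refine le_antisymm ?_ (G.cutUnions_ncard_le_compl A)
  have := G.cutUnions_ncard_le_compl Aᶜ
  rwa [compl_compl] at this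

theorem booleanCut_compl (A : Set V) : G.booleanCut Aᶜ = G.booleanCut A := by
  rw [booleanCut_eq, booleanCut_eq, cutUnions_ncard_compl]

/-- The outer neighbourhood of `x` is the union belonging to `{x}`, seen from the other side of the
cut. -/
theorem outerClasses_le_cutUnions (S : Set V) : G.outerClasses S ≤ (G.cutUnions S).ncard := by
  rw [← G.cutUnions_ncard_compl]
  refine Set.ncard_le_ncard ?_ (Set.toFinite _)
  rintro _ ⟨x, hx, rfl⟩
  refine (G.mem_cutUnions).2 ⟨{x}, by simpa using hx, fun z => ?_⟩
  simp [and_comm]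

theorem cutUnions_le_two_pow (S : Set V) : (G.cutUnions S).ncard ≤ 2 ^ G.outerClasses S := by
  rw [← G.cutUnions_ncard_compl, outerClasses, ← Set.ncard_powerset _ (Set.toFinite _)]
  refine (Set.ncard_le_ncard (t := Set.sUnion '' _) ?_ (Set.toFinite _)).trans
    (Set.ncard_image_le (Set.toFinite _))
  intro X hX
  obtain ⟨Y, hY, hX⟩ := (G.mem_cutUnions).1 hX
  rw [compl_compl] at hY
  refine ⟨(fun x => G.neighborSet x \ S) '' Y, Set.image_mono hY, ?_⟩
  ext z
  rw [hX]
  simp only [Set.sUnion_image, Set.mem_iUnion, Set.mem_sdiff, mem_neighborSet, Set.mem_compl_iff]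
  constructor
  · rintro ⟨y, hy, hyz, hz⟩
    exact ⟨hz, y, hy, hyz⟩
  · rintro ⟨hz, y, hy, hyz⟩
    exact ⟨y, hy, hyz, hz⟩

theorem one_le_cutUnions (S : Set V) : 1 ≤ (G.cutUnions S).ncard := by
  rw [Nat.one_le_iff_ne_zero, ← Nat.pos_iff_ne_zero, Set.ncard_pos (Set.toFinite _)]
  exact ⟨∅, (G.mem_cutUnions).2 ⟨∅, by simp, by simp⟩⟩

theorem booleanCut_nonneg (S : Set V) : 0 ≤ G.booleanCut S :=
  Real.logb_nonneg one_lt_two (by exact_mod_cast G.one_le_cutUnions S)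

theorem booleanCut_le_outerClasses (S : Set V) : G.booleanCut S ≤ G.outerClasses S := by
  have h1 : (1 : ℝ) ≤ (G.cutUnions S).ncard := by exact_mod_cast G.one_le_cutUnions S
  rw [booleanCut_eq, Real.logb_le_iff_le_rpow one_lt_two (by linarith), Real.rpow_natCast]
  exact_mod_cast G.cutUnions_le_two_pow S

theorem booleanCut_univ_le : G.booleanCut Set.univ ≤ 0 := by
  rw [← booleanCut_compl, Set.compl_univ]
  refine (G.booleanCut_le_outerClasses ∅).trans ?_
  simp [outerClasses]

/-- If `a i` and `a j` had the same outer neighbourhood, both `a i`–`b j` and `a j`–`b i` would be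
edges. Only one of them has to be excluded, which is weaker than an induced matching. -/
theorem card_le_outerClasses {ι : Type*} (I : Finset ι) (S : Set V) (a b : ι → V)
    (ha : ∀ i ∈ I, a i ∈ S) (hb : ∀ i ∈ I, b i ∉ S) (hab : ∀ i ∈ I, G.Adj (a i) (b i))
    (hne : ∀ i ∈ I, ∀ j ∈ I, G.Adj (a i) (b j) → G.Adj (a j) (b i) → i = j) :
    I.card ≤ G.outerClasses S := by
  rw [← Set.ncard_coe_finset]
  refine Set.ncard_le_ncard_of_injOn (fun i => G.neighborSet (a i) \ S)
    (fun i hi => ⟨a i, ha i hi, rfl⟩) ?_ (Set.toFinite _)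
  intro i hi j hj h
  change G.neighborSet (a i) \ S = G.neighborSet (a j) \ S at h
  have hij : b j ∈ G.neighborSet (a i) \ S := by
    rw [h]
    exact ⟨hab j hj, hb j hj⟩
  have hji : b i ∈ G.neighborSet (a j) \ S := by
    rw [← h]
    exact ⟨hab i hi, hb i hi⟩
  exact hne i hi j hj hij.1 hji.1

/-- In an induced matching, a set of indices can be read off from the union of neighbourhoods of its
vertices `b i`. -/
theorem two_pow_card_le_cutUnions {ι : Type*} (I : Finset ι) (S : Set V) (a b : ι → V)
    (ha : ∀ i ∈ I, a i ∈ S) (hb : ∀ i ∈ I, b i ∉ S)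
    (hab : ∀ i ∈ I, ∀ j ∈ I, G.Adj (a i) (b j) ↔ i = j) :
    2 ^ I.card ≤ (G.cutUnions S).ncard := by
  rw [← Finset.card_powerset, ← Set.ncard_coe_finset]
  refine Set.ncard_le_ncard_of_injOn (fun F => {z | z ∈ S ∧ ∃ y ∈ b '' (F : Set ι), G.Adj y z})
    ?_ ?_ (Set.toFinite _)
  · intro F hF
    refine (G.mem_cutUnions).2 ⟨b '' F, ?_, fun z => Iff.rfl⟩
    rintro _ ⟨i, hi, rfl⟩
    exact hb i (Finset.mem_powerset.1 hF hi)
  · have key : ∀ F ⊆ I, ∀ i ∈ I, (i ∈ F ↔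
        a i ∈ {z | z ∈ S ∧ ∃ y ∈ b '' (F : Set ι), G.Adj y z}) := by
      intro F hF i hi
      constructor
      · intro h
        exact ⟨ha i hi, b i, ⟨i, h, rfl⟩, ((hab i hi i hi).2 rfl).symm⟩
      · rintro ⟨-, _, ⟨j, hj, rfl⟩, hadj⟩
        rw [(hab i hi j (hF hj)).1 hadj.symm]
        exact hj
    intro F hF F' hF' h
    have hF := Finset.mem_powerset.1 hF
    have hF' := Finset.mem_powerset.1 hF'
    ext i
    constructor
    · intro hi
      exact (key F' hF' i (hF hi)).2 ((Set.ext_iff.1 h _).1 ((key F hF i (hF hi)).1 hi))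
    · intro hi
      exact (key F hF i (hF' hi)).2 ((Set.ext_iff.1 h _).2 ((key F' hF' i (hF' hi)).1 hi))

theorem card_le_booleanCut {ι : Type*} (I : Finset ι) (S : Set V) (a b : ι → V)
    (ha : ∀ i ∈ I, a i ∈ S) (hb : ∀ i ∈ I, b i ∉ S)
    (hab : ∀ i ∈ I, ∀ j ∈ I, G.Adj (a i) (b j) ↔ i = j) :
    (I.card : ℝ) ≤ G.booleanCut S := by
  have h1 : (1 : ℝ) ≤ (G.cutUnions S).ncard := by exact_mod_cast G.one_le_cutUnions S
  rw [booleanCut_eq, Real.le_logb_iff_rpow_le one_lt_two (by linarith), Real.rpow_natCast]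
  exact_mod_cast G.two_pow_card_le_cutUnions I S a b ha hb hab

theorem booleanWidth_le {c : ℝ} (h : BinaryDecomp (fun S => G.booleanCut S ≤ c) Set.univ) :
    G.booleanWidth ≤ c := by
  have hc : 0 ≤ c := (G.booleanCut_nonneg _).trans h.holds
  obtain ⟨D, hD⟩ := h.exists_decompositionTree
  refine csInf_le_of_le ⟨0, ?_⟩ ⟨D, rfl⟩ (D.width_le hc fun u v huv => ?_)
  · rintro _ ⟨D, rfl⟩
    exact D.width_nonneg G.booleanCut_nonneg
  · rcases hD u v huv with h | h
    · exact h
    · rwa [booleanCut_compl] at h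

/-- The hypothesis `hne` yields some decomposition tree, so the infimum is not taken over the empty
set, where it would be `0` by default. -/
theorem le_booleanWidth [Nonempty V] {c : ℝ} (hne : BinaryDecomp (fun _ => True) (Set.univ : Set V))
    (h : ∀ r, BinaryDecomp (fun S => G.booleanCut S ≤ r) Set.univ → c ≤ r) :
    c ≤ G.booleanWidth := by
  obtain ⟨D, -⟩ := hne.exists_decompositionTree
  refine le_csInf ⟨_, D, rfl⟩ ?_
  rintro _ ⟨D, rfl⟩
  exact h _ (D.binaryDecomp_univ (fun u v huv => D.le_width _ huv)
    (G.booleanCut_univ_le.trans (D.width_nonneg G.booleanCut_nonneg)))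

end SimpleGraph

/-! ### Linear decompositions along an enumeration. -/

/-- The elements that precede `m` in an enumeration. -/
def initialPart {V : Type*} {n : ℕ} (e : V ≃ Fin n) (m : ℕ) : Set V := {v | (e v : ℕ) < m}

/-- Induction along the initial parts of an enumeration. -/
theorem initialPart_induction {V : Type*} {n : ℕ} (e : V ≃ Fin n) {Q : Set V → Prop}
    (single : ∀ v, Q {v})
    (step : ∀ m v, 0 < m → (e v : ℕ) = m → Q (initialPart e m) → Q (initialPart e m ∪ {v}))
    (hn : 0 < n) : Q Set.univ := by
  have key : ∀ m, 0 < m → m ≤ n → Q (initialPart e m) := by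
    intro m
    induction m with
    | zero => simp
    | succ m ih =>
      intro _ hm
      have hs : initialPart e (m + 1) = initialPart e m ∪ {e.symm ⟨m, hm⟩} := by
        ext v
        simp only [initialPart, Set.mem_union, Set.mem_singleton_iff, Equiv.eq_symm_apply,
          Fin.ext_iff, Set.mem_ofPred_eq]
        omega
      rw [hs]
      rcases Nat.eq_zero_or_pos m with rfl | h0
      · have : initialPart e 0 = ∅ := by simp [initialPart]
        rw [this, Set.empty_union]
        exact single _
      · exact step m _ h0 (by simp) (ih h0 (Nat.le_of_succ_le hm))
  have hu : initialPart e n = Set.univ := Set.eq_univ_of_forall fun v => (e v).2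
  rw [← hu]
  exact key n hn le_rfl

theorem initialPart_union_singleton {V : Type*} {n : ℕ} (e : V ≃ Fin n) {m : ℕ} {v : V}
    (hv : (e v : ℕ) = m) : initialPart e m ∪ {v} = initialPart e (m + 1) := by
  ext w
  have : w = v ↔ (e w : ℕ) = m := by rw [← hv, ← Fin.ext_iff, e.injective.eq_iff]
  simp only [initialPart, Set.mem_union, Set.mem_singleton_iff, this, Set.mem_ofPred_eq]
  omega

theorem disjoint_initialPart_singleton {V : Type*} {n : ℕ} (e : V ≃ Fin n) {m : ℕ} {v : V}
    (hv : (e v : ℕ) = m) : Disjoint (initialPart e m) {v} := by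
  simp [initialPart, hv]

theorem BinaryDecomp.of_initialPart {V : Type*} {n : ℕ} (e : V ≃ Fin n) {P : Set V → Prop}
    (single : ∀ v, P {v}) (part : ∀ m, 1 < m → m ≤ n → P (initialPart e m)) (hn : 0 < n) :
    BinaryDecomp P Set.univ :=
  initialPart_induction e (fun v => .single v (single v)) (fun m v h0 hv ih =>
    .union (disjoint_initialPart_singleton e hv) ih (.single v (single v))
      (initialPart_union_singleton e hv ▸ part _ (by omega) (by have := (e v).2; omega))) hn

theorem BinaryDecomp.true_univ (V : Type*) [Finite V] [Nonempty V] :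
    BinaryDecomp (fun _ => True) (Set.univ : Set V) :=
  .of_initialPart (Finite.equivFin V) (fun _ => trivial) (fun _ _ _ => trivial) Nat.card_pos

/-! ### Operations on clique-width expressions. -/

/-- `Constructs k A H ℓ`: some expression with `k` labels constructs the restriction of the
relation `H` to `A`, and labels its vertices by `ℓ`. -/
def Constructs {V : Type*} (k : ℕ) (A : Set V) (H : V → V → Prop) (ℓ : V → Fin k) : Prop :=
  ∃ (e : CliqueExpr k) (φ : e.Vert → V), Function.Injective φ ∧ Set.range φ = A ∧
    (∀ x y, e.graph.Adj x y ↔ H (φ x) (φ y)) ∧ ∀ x, e.label x = ℓ (φ x)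

namespace CliqueExpr

variable {k : ℕ}

theorem join_adj {i j : Fin k} (hij : i ≠ j) {e : CliqueExpr k} (x y : e.Vert) :
    SimpleGraph.Adj (V := e.Vert) (join i j hij e).graph x y ↔
      e.graph.Adj x y ∨ (e.label x = i ∧ e.label y = j ∨ e.label y = i ∧ e.label x = j) := by
  change e.graph.Adj x y ∨
    (SimpleGraph.fromRel fun x y : e.Vert => e.label x = i ∧ e.label y = j).Adj x y ↔ _
  rw [SimpleGraph.fromRel_adj]
  refine or_congr Iff.rfl (and_iff_right_of_imp ?_)
  rintro h rfl
  rcases h with ⟨h1, h2⟩ | ⟨h1, h2⟩ <;> exact hij (h1.symm.trans h2)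

theorem not_adj_inl_inr {e f : CliqueExpr k} (x : e.Vert) (y : f.Vert) :
    ¬ (e.graph ⊕g f.graph).Adj (.inl x) (.inr y) := by simp

theorem not_adj_inr_inl {e f : CliqueExpr k} (x : e.Vert) (y : f.Vert) :
    ¬ (e.graph ⊕g f.graph).Adj (.inr y) (.inl x) := by simp

/-- The expression with all labels permuted. -/
def permLabels (σ : Equiv.Perm (Fin k)) : CliqueExpr k → CliqueExpr k
  | vertex i => vertex (σ i)
  | disjUnion e₁ e₂ => disjUnion (e₁.permLabels σ) (e₂.permLabels σ)
  | join i j hij e => join (σ i) (σ j) (σ.injective.ne hij) (e.permLabels σ)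
  | rename i j e => rename (σ i) (σ j) (e.permLabels σ)

/-- Permuting the labels does not change the vertices. -/
def permVert (σ : Equiv.Perm (Fin k)) : (e : CliqueExpr k) → (e.permLabels σ).Vert ≃ e.Vert
  | vertex _ => Equiv.refl _
  | disjUnion e₁ e₂ => Equiv.sumCongr (permVert σ e₁) (permVert σ e₂)
  | join _ _ _ e => permVert σ e
  | rename _ _ e => permVert σ e

theorem label_permVert (σ : Equiv.Perm (Fin k)) (e : CliqueExpr k) (x : (e.permLabels σ).Vert) :
    (e.permLabels σ).label x = σ (e.label (permVert σ e x)) := by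
  induction e with
  | vertex i => rfl
  | disjUnion e₁ e₂ ih₁ ih₂ =>
    rcases x with x | x
    · exact ih₁ x
    · exact ih₂ x
  | join i j hij e ih => exact ih x
  | rename i j e ih =>
    have h : ∀ x : (e.permLabels σ).Vert,
        (if (e.permLabels σ).label x = σ i then σ j else (e.permLabels σ).label x) =
          σ (if e.label (permVert σ e x) = i then j else e.label (permVert σ e x)) := by
      intro x
      simp only [ih, σ.injective.eq_iff]
      split_ifs <;> rfl
    exact h x

theorem adj_permVert (σ : Equiv.Perm (Fin k)) (e : CliqueExpr k) (x y : (e.permLabels σ).Vert) :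
    (e.permLabels σ).graph.Adj x y ↔ e.graph.Adj (permVert σ e x) (permVert σ e y) := by
  induction e with
  | vertex i => exact Iff.rfl
  | disjUnion e₁ e₂ ih₁ ih₂ =>
    rcases x with x | x <;> rcases y with y | y
    · exact ih₁ x y
    · exact Iff.rfl
    · exact Iff.rfl
    · exact ih₂ x y
  | join i j hij e ih =>
    have h : ∀ x y : (e.permLabels σ).Vert,
        ((e.permLabels σ).graph.Adj x y ∨
          ((e.permLabels σ).label x = σ i ∧ (e.permLabels σ).label y = σ j ∨
            (e.permLabels σ).label y = σ i ∧ (e.permLabels σ).label x = σ j)) ↔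
        (e.graph.Adj (permVert σ e x) (permVert σ e y) ∨
          (e.label (permVert σ e x) = i ∧ e.label (permVert σ e y) = j ∨
            e.label (permVert σ e y) = i ∧ e.label (permVert σ e x) = j)) := by
      intro x y
      simp only [ih, label_permVert, σ.injective.eq_iff]
    exact (join_adj _ _ _).trans ((h x y).trans (join_adj hij _ _).symm)
  | rename i j e ih => exact ih x y

end CliqueExpr

namespace Constructs

variable {V : Type*} {k : ℕ} {A B : Set V} {H H' : V → V → Prop} {ℓ ℓ' : V → Fin k}

theorem congr (h : Constructs k A H ℓ) (hH : ∀ x ∈ A, ∀ y ∈ A, H x y ↔ H' x y)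
    (hℓ : ∀ x ∈ A, ℓ x = ℓ' x) : Constructs k A H' ℓ' := by
  obtain ⟨e, φ, hi, rfl, hadj, hl⟩ := h
  exact ⟨e, φ, hi, rfl, fun x y => (hadj x y).trans (hH _ ⟨x, rfl⟩ _ ⟨y, rfl⟩),
    fun x => (hl x).trans (hℓ _ ⟨x, rfl⟩)⟩

theorem singleton (v : V) (hH : ¬ H v v) : Constructs k {v} H ℓ :=
  ⟨.vertex (ℓ v), fun _ => v, fun _ _ _ => rfl, Set.range_const (ι := Unit),
    fun _ _ => iff_of_false id hH, fun _ => rfl⟩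

theorem perm (h : Constructs k A H ℓ) (σ : Equiv.Perm (Fin k)) :
    Constructs k A H fun x => σ (ℓ x) := by
  obtain ⟨e, φ, hi, rfl, hadj, hl⟩ := h
  refine ⟨e.permLabels σ, φ ∘ e.permVert σ, hi.comp (e.permVert σ).injective, ?_, ?_, ?_⟩
  · exact (e.permVert σ).surjective.range_comp φ
  · intro x y
    rw [CliqueExpr.adj_permVert, hadj]
    rfl
  · intro x
    rw [CliqueExpr.label_permVert, hl]
    rfl

theorem union (hd : Disjoint A B) (hA : Constructs k A H ℓ) (hB : Constructs k B H ℓ)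
    (hH : ∀ x ∈ A, ∀ y ∈ B, ¬ H x y ∧ ¬ H y x) : Constructs k (A ∪ B) H ℓ := by
  obtain ⟨e, φ, hi, rfl, hadj, hl⟩ := hA
  obtain ⟨f, ψ, hi', rfl, hadj', hl'⟩ := hB
  refine ⟨.disjUnion e f, Sum.elim φ ψ, ?_, Set.Sum.elim_range φ ψ, ?_, ?_⟩
  · refine hi.sumElim hi' fun x y h => ?_
    exact Set.disjoint_left.1 hd ⟨x, rfl⟩ ⟨y, h.symm⟩
  · rintro (x | x) (y | y)
    · exact hadj x y
    · exact iff_of_false (CliqueExpr.not_adj_inl_inr x y) (hH _ ⟨x, rfl⟩ _ ⟨y, rfl⟩).1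
    · exact iff_of_false (CliqueExpr.not_adj_inr_inl y x) (hH _ ⟨y, rfl⟩ _ ⟨x, rfl⟩).2
    · exact hadj' x y
  · rintro (x | x)
    · exact hl x
    · exact hl' x

theorem join (h : Constructs k A H ℓ) {i j : Fin k} (hij : i ≠ j) :
    Constructs k A (fun x y => H x y ∨ (ℓ x = i ∧ ℓ y = j) ∨ (ℓ y = i ∧ ℓ x = j)) ℓ := by
  obtain ⟨e, φ, hi, rfl, hadj, hl⟩ := h
  refine ⟨.join i j hij e, φ, hi, rfl, fun x y => (CliqueExpr.join_adj hij (e := e) x y).trans ?_, hl⟩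
  exact or_congr (hadj x y) (by rw [← hl x, ← hl y])

theorem joinPairs (h : Constructs k A H ℓ) (J : Finset (Fin k × Fin k)) (hJ : ∀ p ∈ J, p.1 ≠ p.2) :
    Constructs k A (fun x y => H x y ∨ (ℓ x, ℓ y) ∈ J ∨ (ℓ y, ℓ x) ∈ J) ℓ := by
  induction J using Finset.induction_on with
  | empty => simpa using h
  | insert p J _ ih =>
    have h' := (ih fun q hq => hJ q (Finset.mem_insert_of_mem hq)).join
      (hJ p (Finset.mem_insert_self _ _))
    refine h'.congr (fun x _ y _ => ?_) fun _ _ => rfl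
    simp only [Finset.mem_insert, Prod.ext_iff]
    tauto

/-- Labels are renamed one after another. Idempotence of `r` makes the order irrelevant: a label
already moved to `r i` stays there when `r i` is treated in turn. -/
theorem relabel (h : Constructs k A H ℓ) (r : Fin k → Fin k) (hr : ∀ i, r (r i) = r i) :
    Constructs k A H fun x => r (ℓ x) := by
  have key : ∀ s : Finset (Fin k), Constructs k A H fun x => if ℓ x ∈ s then r (ℓ x) else ℓ x := by
    intro s
    induction s using Finset.induction_on with
    | empty => simpa using h
    | insert i s _ ih =>
      obtain ⟨e, φ, hi, rfl, hadj, hl⟩ := ih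
      refine ⟨.rename i (r i) e, φ, hi, rfl, hadj, fun x => ?_⟩
      have h' : ∀ x : e.Vert, (if e.label x = i then r i else e.label x) =
          if ℓ (φ x) ∈ insert i s then r (ℓ (φ x)) else ℓ (φ x) := by
        intro x
        rw [hl]
        simp only [Finset.mem_insert]
        by_cases h1 : ℓ (φ x) ∈ s
        · simp only [h1, if_true, or_true]
          split_ifs with h2
          · rw [← h2, hr]
          · rfl
        · simp only [h1, if_false, or_false]
          split_ifs with h2
          · rw [h2]
          · rfl
      exact h' x
  simpa using key Finset.univ

end Constructs

/-! ### From binary decompositions to expressions. -/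

namespace SimpleGraph

variable {V : Type*} (G : SimpleGraph V) {k : ℕ} {A B : Set V}

/-- The set `A` can be constructed with `k` labels in such a way that two vertices have the same
label if and only if they have the same neighbours outside `A`. -/
def IsConstructible (k : ℕ) (A : Set V) : Prop :=
  ∃ ℓ : V → Fin k, Constructs k A G.Adj ℓ ∧
    ∀ x ∈ A, ∀ y ∈ A, ℓ x = ℓ y ↔ G.neighborSet x \ A = G.neighborSet y \ A

theorem isConstructible_singleton (hk : 0 < k) (v : V) : G.IsConstructible k {v} :=
  ⟨fun _ => ⟨0, hk⟩, .singleton v (G.loopless.irrefl v), by simp⟩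

theorem ncard_labels {ℓ : V → Fin k}
    (h : ∀ x ∈ A, ∀ y ∈ A, ℓ x = ℓ y ↔ G.neighborSet x \ A = G.neighborSet y \ A) :
    (ℓ '' A).ncard = G.outerClasses A := by
  refine Set.ncard_congr (fun i hi => G.neighborSet hi.choose \ A) ?_ ?_ ?_
  · intro i hi
    exact ⟨_, hi.choose_spec.1, rfl⟩
  · intro i j hi hj hij
    rw [← hi.choose_spec.2, ← hj.choose_spec.2]
    exact (h _ hi.choose_spec.1 _ hj.choose_spec.1).2 hij
  · rintro _ ⟨x, hx, rfl⟩
    have hi : ℓ x ∈ ℓ '' A := ⟨x, hx, rfl⟩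
    exact ⟨ℓ x, hi, (h _ hi.choose_spec.1 _ hx).1 hi.choose_spec.2⟩

theorem exists_perm_disjoint {s t : Set (Fin k)} (h : s.ncard + t.ncard ≤ k) :
    ∃ σ : Equiv.Perm (Fin k), Disjoint s (σ '' t) := by
  classical
  have hle : t.ncard ≤ sᶜ.ncard := by
    have := Set.ncard_add_ncard_compl s
    rw [Nat.card_fin] at this
    omega
  obtain ⟨u, hu, hut⟩ := Set.exists_subset_card_eq hle
  have e : t ≃ u := Classical.choice (Finite.card_eq.1 (by rw [Nat.card_coe_set_eq, Nat.card_coe_set_eq, hut]))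
  refine ⟨e.extendSubtype, ?_⟩
  rw [Set.disjoint_right]
  rintro _ ⟨x, hx, rfl⟩
  exact hu (e.extendSubtype_mem x hx)

/-- Choose a representative of each class and rename every used label to the label of the
representative of its class. This renaming is idempotent, so `Constructs.relabel` applies. -/
theorem IsConstructible.merge {ℓ : V → Fin k} (h : Constructs k A G.Adj ℓ)
    (hℓ : ∀ x ∈ A, ∀ y ∈ A, ℓ x = ℓ y → G.neighborSet x \ A = G.neighborSet y \ A) :
    G.IsConstructible k A := by
  classical
  rcases A.eq_empty_or_nonempty with rfl | ⟨a, ha⟩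
  · exact ⟨ℓ, h, by simp⟩
  let c : V → Set V := fun x => G.neighborSet x \ A
  have hrep : ∀ s : Set V, ∃ y ∈ A, (∃ x ∈ A, c x = s) → c y = s := by
    intro s
    by_cases hs : ∃ x ∈ A, c x = s
    · exact ⟨hs.choose, hs.choose_spec.1, fun _ => hs.choose_spec.2⟩
    · exact ⟨a, ha, fun h => (hs h).elim⟩
  choose rep hrepA hrep using hrep
  have hrep' : ∀ x ∈ A, c (rep (c x)) = c x := fun x hx => hrep _ ⟨x, hx, rfl⟩
  let r : Fin k → Fin k := fun i =>
    if hi : ∃ x ∈ A, ℓ x = i then ℓ (rep (c hi.choose)) else i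
  have hr : ∀ x ∈ A, r (ℓ x) = ℓ (rep (c x)) := by
    intro x hx
    have hi : ∃ y ∈ A, ℓ y = ℓ x := ⟨x, hx, rfl⟩
    have : c hi.choose = c x := hℓ _ hi.choose_spec.1 _ hx hi.choose_spec.2
    simp only [r, dif_pos hi, this]
  have hrr : ∀ i, r (r i) = r i := by
    intro i
    by_cases hi : ∃ x ∈ A, ℓ x = i
    · obtain ⟨x, hx, rfl⟩ := hi
      rw [hr x hx, hr _ (hrepA _), hrep' x hx]
    · have : r i = i := by simp only [r, dif_neg hi]
      rw [this, this]
  refine ⟨fun x => r (ℓ x), h.relabel r hrr, fun x hx y hy => ?_⟩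
  beta_reduce
  rw [hr x hx, hr y hy]
  constructor
  · intro hxy
    have := hℓ _ (hrepA _) _ (hrepA _) hxy
    exact ((hrep' x hx).symm.trans this).trans (hrep' y hy)
  · intro hxy
    change c x = c y at hxy
    rw [hxy]

variable {G}

/-- Each part uses exactly as many labels as it has classes, so a permutation makes the two label
sets disjoint. Adjacency between the parts then depends on the labels alone, and joins between
suitable label pairs create precisely the missing edges. Vertices of equal label agree outside the
union, so the labels can be merged. -/
theorem IsConstructible.union (hd : Disjoint A B) (hA : G.IsConstructible k A)
    (hB : G.IsConstructible k B) (hk : G.outerClasses A + G.outerClasses B ≤ k) :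
    G.IsConstructible k (A ∪ B) := by
  classical
  obtain ⟨ℓ₁, c₁, h₁⟩ := hA
  obtain ⟨ℓ₂, c₂, h₂⟩ := hB
  rw [← G.ncard_labels h₁, ← G.ncard_labels h₂] at hk
  obtain ⟨σ, hσ⟩ := exists_perm_disjoint hk
  have hBA : ∀ x ∈ B, x ∉ A := fun x hx => hd.notMem_of_mem_right hx
  let ℓ : V → Fin k := fun x => if x ∈ A then ℓ₁ x else σ (ℓ₂ x)
  have hℓA : ∀ x ∈ A, ℓ x = ℓ₁ x := fun x hx => if_pos hx
  have hℓB : ∀ x ∈ B, ℓ x = σ (ℓ₂ x) := fun x hx => if_neg (hBA x hx)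
  have hAB : ∀ x ∈ A, ∀ y ∈ B, ℓ x ≠ ℓ y := by
    intro x hx y hy h
    rw [hℓA x hx, hℓB y hy] at h
    exact Set.disjoint_left.1 hσ ⟨x, hx, h⟩ ⟨ℓ₂ y, ⟨y, hy, rfl⟩, rfl⟩
  have hsA : ∀ x ∈ A, ∀ y ∈ A, ℓ x = ℓ y → ∀ z ∉ A, G.Adj x z ↔ G.Adj y z := by
    intro x hx y hy h z hz
    rw [hℓA x hx, hℓA y hy, h₁ x hx y hy] at h
    simpa [hz] using Set.ext_iff.1 h z
  have hsB : ∀ x ∈ B, ∀ y ∈ B, ℓ x = ℓ y → ∀ z ∉ B, G.Adj x z ↔ G.Adj y z := by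
    intro x hx y hy h z hz
    rw [hℓB x hx, hℓB y hy, σ.injective.eq_iff, h₂ x hx y hy] at h
    simpa [hz] using Set.ext_iff.1 h z
  let H : V → V → Prop := fun x y => (x ∈ A ∧ y ∈ A ∨ x ∈ B ∧ y ∈ B) ∧ G.Adj x y
  have hU : Constructs k (A ∪ B) H ℓ := by
    refine Constructs.union hd (c₁.congr ?_ fun x hx => (hℓA x hx).symm)
      ((c₂.perm σ).congr ?_ fun x hx => (hℓB x hx).symm) ?_
    · intro x hx y hy
      simp [H, hx, hy]
    · intro x hx y hy
      simp [H, hx, hy]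
    · intro x hx y hy
      simp [H, hx, hBA y hy, hd.notMem_of_mem_left hx]
  let J : Finset (Fin k × Fin k) :=
    Finset.univ.filter fun p => ∃ x ∈ A, ∃ y ∈ B, G.Adj x y ∧ ℓ x = p.1 ∧ ℓ y = p.2
  have hJ : ∀ p ∈ J, p.1 ≠ p.2 := by
    intro p hp
    obtain ⟨x, hx, y, hy, -, h1, h2⟩ := (Finset.mem_filter.1 hp).2
    rw [← h1, ← h2]
    exact hAB x hx y hy
  have hJA : ∀ x ∈ A, ∀ y ∈ B, (ℓ x, ℓ y) ∈ J ↔ G.Adj x y := by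
    intro x hx y hy
    rw [Finset.mem_filter]
    constructor
    · rintro ⟨-, x', hx', y', hy', h, h1, h2⟩
      rw [← hsA x' hx' x hx h1 y (hBA y hy), adj_comm,
        ← hsB y' hy' y hy h2 x' (hd.notMem_of_mem_left hx'), adj_comm]
      exact h
    · intro h
      exact ⟨Finset.mem_univ _, x, hx, y, hy, h, rfl, rfl⟩
  have hJn : ∀ x ∈ A ∪ B, ∀ y ∈ A ∪ B, (ℓ x, ℓ y) ∈ J → x ∈ A ∧ y ∈ B := by
    intro x hx y hy h
    obtain ⟨x', hx', y', hy', -, h1, h2⟩ := (Finset.mem_filter.1 h).2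
    refine ⟨hx.resolve_right fun h => hAB x' hx' x h h1, hy.resolve_left fun h => ?_⟩
    exact hAB y h y' hy' h2.symm
  refine IsConstructible.merge G ((hU.joinPairs J hJ).congr ?_ fun _ _ => rfl) ?_
  · intro x hx y hy
    constructor
    · rintro (h | h | h)
      · exact h.2
      · obtain ⟨h1, h2⟩ := hJn x hx y hy h
        exact (hJA x h1 y h2).1 h
      · obtain ⟨h1, h2⟩ := hJn y hy x hx h
        exact ((hJA y h1 x h2).1 h).symm
    · intro h
      rcases hx with hx | hx <;> rcases hy with hy | hy
      · exact Or.inl ⟨Or.inl ⟨hx, hy⟩, h⟩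
      · exact Or.inr (Or.inl ((hJA x hx y hy).2 h))
      · exact Or.inr (Or.inr ((hJA y hy x hx).2 h.symm))
      · exact Or.inl ⟨Or.inr ⟨hx, hy⟩, h⟩
  · intro x hx y hy h
    ext z
    rw [Set.mem_sdiff, Set.mem_sdiff, mem_neighborSet, mem_neighborSet]
    refine and_congr_left fun hz => ?_
    rw [Set.mem_union, not_or] at hz
    rcases hx with hx | hx <;> rcases hy with hy | hy
    · exact hsA x hx y hy h z hz.1
    · exact (hAB x hx y hy h).elim
    · exact (hAB y hy x hx h.symm).elim
    · exact hsB x hx y hy h z hz.2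

theorem IsConstructible.exists_iso (h : G.IsConstructible k Set.univ) :
    ∃ e : CliqueExpr k, Nonempty (e.graph ≃g G) := by
  obtain ⟨ℓ, ⟨e, φ, hi, hs, hadj, -⟩, -⟩ := h
  exact ⟨e, ⟨⟨Equiv.ofBijective φ ⟨hi, Set.range_eq_univ.1 hs⟩, (hadj _ _).symm⟩⟩⟩

theorem IsConstructible.cliqueWidth_le (h : G.IsConstructible k Set.univ) : G.cliqueWidth ≤ k :=
  Nat.sInf_le h.exists_iso

theorem outerClasses_pos [Finite V] (h : A.Nonempty) : 0 < G.outerClasses A := by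
  rw [outerClasses, Set.ncard_pos (Set.toFinite _)]
  exact h.image _

/-- At each union, both parts have at most `m` classes, whence `2 * m` labels. -/
theorem isConstructible_of_binaryDecomp [Finite V] {m : ℕ}
    (h : BinaryDecomp (fun S => G.outerClasses S ≤ m) A) : G.IsConstructible (2 * m) A := by
  induction h with
  | single v h =>
    have := (outerClasses_pos (G := G) (Set.singleton_nonempty v)).trans_le h
    exact G.isConstructible_singleton (by omega) v
  | union hd hA hB h ihA ihB =>
    refine .union hd ihA ihB ?_
    have h1 := hA.holds
    have h2 := hB.holds
    omega

theorem outerClasses_singleton (v : V) : G.outerClasses {v} = 1 := by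
  simp [outerClasses]

theorem isConstructible_of_initialPart {n m : ℕ} (e : V ≃ Fin n) (hn : 0 < n)
    (h : ∀ l, G.outerClasses (initialPart e l) ≤ m) : G.IsConstructible (m + 1) Set.univ :=
  initialPart_induction e (fun v => G.isConstructible_singleton (by omega) v)
    (fun l v _ hv ih => .union (disjoint_initialPart_singleton e hv) ih
      (G.isConstructible_singleton (by omega) v)
      (by rw [outerClasses_singleton]; exact Nat.add_le_add_right (h l) 1)) hn

/-- Some number of labels suffices, by the trivial bound of `Nat.card V` classes; hence the minimum
is attained. -/
theorem exists_iso_cliqueWidth [Finite V] [Nonempty V] :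
    ∃ e : CliqueExpr G.cliqueWidth, Nonempty (e.graph ≃g G) := by
  have h : BinaryDecomp (fun S => G.outerClasses S ≤ Nat.card V) Set.univ :=
    (BinaryDecomp.true_univ V).mono fun S _ => (Set.ncard_image_le (Set.toFinite _)).trans
      (Set.ncard_le_card S)
  exact Nat.sInf_mem (s := {k : ℕ | ∃ e : CliqueExpr k, Nonempty (e.graph ≃g G)})
    ⟨_, (isConstructible_of_binaryDecomp h).exists_iso⟩

/-! ### From expressions to binary decompositions, and the general inequalities. -/

theorem outerClasses_range_le {W : Type*} (φ : W → V) (ℓ : W → Fin k)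
    (h : ∀ x y, ℓ x = ℓ y → ∀ z ∉ Set.range φ, G.Adj (φ x) z ↔ G.Adj (φ y) z) :
    G.outerClasses (Set.range φ) ≤ k := by
  rw [outerClasses, ← Set.range_comp, ← Nat.card_coe_set_eq]
  refine (Nat.card_le_card_of_injective (β := Fin k) (fun i => ℓ i.2.choose) ?_).trans
    (Nat.card_fin k).le
  intro i j hij
  apply Subtype.ext
  rw [← i.2.choose_spec, ← j.2.choose_spec]
  ext z
  simp only [Function.comp, Set.mem_sdiff, mem_neighborSet]
  exact and_congr_left fun hz => h _ _ hij z hz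

/-- The relation `K` records the edges added by operations outside the subexpression `e`. They
depend only on the labels at the end of `e`, and this form of the hypothesis passes to
subexpressions. -/
theorem binaryDecomp_range (e : CliqueExpr k) (φ : e.Vert → V) (hφ : Function.Injective φ)
    (K : Fin k → Fin k → Prop)
    (hadj : ∀ x y, G.Adj (φ x) (φ y) ↔ e.graph.Adj x y ∨ K (e.label x) (e.label y))
    (hout : ∀ x y, e.label x = e.label y → ∀ z ∉ Set.range φ, G.Adj (φ x) z ↔ G.Adj (φ y) z) :
    BinaryDecomp (fun S => G.outerClasses S ≤ k) (Set.range φ) := by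
  have hP := outerClasses_range_le φ e.label hout
  induction e generalizing K with
  | vertex i =>
    have : Set.range φ = {φ ()} := Set.range_unique (ι := Unit)
    rw [this] at hP ⊢
    exact .single _ hP
  | disjUnion e f ihe ihf =>
    change e.Vert ⊕ f.Vert → V at φ
    replace hφ : Function.Injective φ := hφ
    have hadj' : ∀ x y, G.Adj (φ (.inl x)) (φ (.inr y)) ↔ K (e.label x) (f.label y) :=
      fun x y => (hadj (.inl x) (.inr y)).trans
        (or_iff_right (CliqueExpr.not_adj_inl_inr x y))
    have hr : Set.range φ = Set.range (φ ∘ Sum.inl) ∪ Set.range (φ ∘ Sum.inr) := by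
      rw [Set.range_comp, Set.range_comp, ← Set.image_union, Set.range_inl_union_range_inr,
        Set.image_univ]
    have heout : ∀ x y, e.label x = e.label y → ∀ z ∉ Set.range (φ ∘ Sum.inl),
        G.Adj (φ (.inl x)) z ↔ G.Adj (φ (.inl y)) z := by
      intro x y hxy z hz
      by_cases hz' : z ∈ Set.range (φ ∘ Sum.inr)
      · obtain ⟨w, rfl⟩ := hz'
        exact (hadj' x w).trans (hxy ▸ (hadj' y w).symm)
      · exact hout (.inl x) (.inl y) hxy z (fun h => by
          have h : z ∈ Set.range φ := h
          rw [hr] at h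
          exact h.elim hz hz')
    have hfout : ∀ x y, f.label x = f.label y → ∀ z ∉ Set.range (φ ∘ Sum.inr),
        G.Adj (φ (.inr x)) z ↔ G.Adj (φ (.inr y)) z := by
      intro x y hxy z hz
      by_cases hz' : z ∈ Set.range (φ ∘ Sum.inl)
      · obtain ⟨w, rfl⟩ := hz'
        rw [Function.comp_apply, G.adj_comm _ (φ (.inl w)), G.adj_comm _ (φ (.inl w))]
        exact (hadj' w x).trans (hxy ▸ (hadj' w y).symm)
      · exact hout (.inr x) (.inr y) hxy z (fun h => by
          have h : z ∈ Set.range φ := h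
          rw [hr] at h
          exact h.elim hz' hz)
    change BinaryDecomp _ (Set.range φ)
    replace hP : G.outerClasses (Set.range φ) ≤ k := hP
    rw [hr] at hP ⊢
    refine .union ?_
      (ihe _ (hφ.comp Sum.inl_injective) K (fun x y => hadj (.inl x) (.inl y)) heout
        (outerClasses_range_le _ e.label heout))
      (ihf _ (hφ.comp Sum.inr_injective) K (fun x y => hadj (.inr x) (.inr y)) hfout
        (outerClasses_range_le _ f.label hfout)) hP
    rw [Set.disjoint_left]
    rintro _ ⟨x, rfl⟩ ⟨y, hy⟩
    cases hφ hy
  | join i j hij e ih =>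
    refine ih φ hφ (fun a b => K a b ∨ (a = i ∧ b = j) ∨ (b = i ∧ a = j)) (fun x y => ?_) hout hP
    refine (hadj x y).trans ((or_congr_left (CliqueExpr.join_adj hij (e := e) x y)).trans ?_)
    change (_ ∨ K (e.label x) (e.label y)) ↔ _
    tauto
  | rename i j e ih =>
    -- Edges added after the renaming depend on the new labels, so `K` is pulled back along it.
    exact ih φ hφ (fun a b => K (if a = i then j else a) (if b = i then j else b))
      hadj (fun x y hxy => hout x y (congrArg (fun a => if a = i then j else a) hxy)) hP

theorem binaryDecomp_cliqueWidth [Finite V] [Nonempty V] :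
    BinaryDecomp (fun S => G.outerClasses S ≤ G.cliqueWidth) Set.univ := by
  obtain ⟨e, ⟨φ⟩⟩ := G.exists_iso_cliqueWidth
  have h := binaryDecomp_range (G := G) e φ φ.injective (fun _ _ => False) (fun x y => by
    rw [or_false]
    exact φ.map_adj_iff) fun x y _ z hz => (hz (φ.surjective z)).elim
  rwa [φ.surjective.range_eq] at h

variable (G) in
theorem booleanWidth_le_cliqueWidth [Finite V] [Nonempty V] : G.booleanWidth ≤ G.cliqueWidth :=
  G.booleanWidth_le (G.binaryDecomp_cliqueWidth.mono fun S h =>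
    (G.booleanCut_le_outerClasses S).trans (by exact_mod_cast h))

variable (G) in
theorem cliqueWidth_pos [Finite V] [Nonempty V] : 0 < G.cliqueWidth :=
  (outerClasses_pos Set.univ_nonempty).trans_le G.binaryDecomp_cliqueWidth.holds

-- A cut of boolean value at most `r` has at most 2^r unions, hence at most ⌊2^r⌋ classes; the
-- factor two in the number of labels becomes the summand `1`.
variable (G) in
theorem logb_cliqueWidth_sub_one_le [Finite V] [Nonempty V] :
    Real.logb 2 G.cliqueWidth - 1 ≤ G.booleanWidth := by
  refine G.le_booleanWidth (.true_univ V) fun r hr => ?_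
  have h : BinaryDecomp (fun S => G.outerClasses S ≤ ⌊(2 : ℝ) ^ r⌋₊) Set.univ := by
    refine hr.mono fun S hS => ?_
    refine (G.outerClasses_le_cutUnions S).trans (Nat.le_floor ?_)
    rwa [booleanCut_eq, Real.logb_le_iff_le_rpow one_lt_two
      (by exact_mod_cast G.one_le_cutUnions S)] at hS
  have h1 := (isConstructible_of_binaryDecomp h).cliqueWidth_le
  have h2 : (G.cliqueWidth : ℝ) ≤ 2 * 2 ^ r := by
    calc (G.cliqueWidth : ℝ) ≤ ((2 * ⌊(2 : ℝ) ^ r⌋₊ : ℕ) : ℝ) := by exact_mod_cast h1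
      _ = 2 * (⌊(2 : ℝ) ^ r⌋₊ : ℝ) := by push_cast; ring
      _ ≤ 2 * 2 ^ r := by
        have := Nat.floor_le (Real.rpow_nonneg zero_le_two r : (0 : ℝ) ≤ 2 ^ r)
        linarith
  rw [sub_le_iff_le_add, Real.logb_le_iff_le_rpow one_lt_two
    (by exact_mod_cast G.cliqueWidth_pos), Real.rpow_add_one two_ne_zero]
  linarith

end SimpleGraph

/-! ### Cuts that split many rows or all columns. -/

theorem exists_adjacent_of_mixed {n : ℕ} {s : Fin n → Prop} (h : ∃ j, s j) (h' : ∃ j, ¬ s j) :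
    ∃ a b : Fin n, ((a : ℕ) + 1 = b ∨ (b : ℕ) + 1 = a) ∧ s a ∧ ¬ s b := by
  by_contra! hc
  obtain ⟨⟨a, ha⟩, hsa⟩ := h
  obtain ⟨⟨b, hb⟩, hsb⟩ := h'
  have key : ∀ m (hm : m < n), s ⟨m, hm⟩ ↔ s ⟨0, by omega⟩ := by
    intro m
    induction m with
    | zero => exact fun _ => Iff.rfl
    | succ m ih =>
      intro hm
      rw [← ih (by omega)]
      exact ⟨hc ⟨m + 1, hm⟩ ⟨m, by omega⟩ (Or.inr rfl), hc ⟨m, by omega⟩ ⟨m + 1, hm⟩ (Or.inl rfl)⟩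
  exact hsb ((key b hb).2 ((key a ha).1 hsa))

section mixed

variable {p q : ℕ}

/-- A row that meets both `S` and its complement. -/
def MixedRow (S : Set (Fin p × Fin q)) (i : Fin p) : Prop := (∃ j, (i, j) ∈ S) ∧ ∃ j, (i, j) ∉ S

/-- A column that meets both `S` and its complement. -/
def MixedCol (S : Set (Fin p × Fin q)) (j : Fin q) : Prop := (∃ i, (i, j) ∈ S) ∧ ∃ i, (i, j) ∉ S

-- Descend to a set that contains a full row while neither of its two parts does. If it misses some
-- row, every column is mixed. Otherwise each row is either mixed for this set, or contained in it
-- and then mixed for the part `A`; one of the two sets has at least half of the rows.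
open Classical in
theorem BinaryDecomp.exists_mixed {P : Set (Fin p × Fin q) → Prop} {A : Set (Fin p × Fin q)}
    (h : BinaryDecomp P A) (hq : 2 ≤ q) (hA : ∃ i, ∀ j, (i, j) ∈ A) :
    ∃ S, P S ∧ (p ≤ 2 * (Finset.univ.filter (MixedRow S)).card ∨ ∀ j, MixedCol S j) := by
  induction h with
  | single v h =>
    obtain ⟨i, hi⟩ := hA
    have h0 : (i, (⟨0, by omega⟩ : Fin q)) = v := hi _
    have h1 : (i, (⟨1, by omega⟩ : Fin q)) = v := hi _
    have := congrArg (fun z => (z.2 : ℕ)) (h0.trans h1.symm)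
    simp at this
  | @union A B hd hA' hB' h ihA ihB =>
    by_cases hfA : ∃ i, ∀ j, (i, j) ∈ A
    · exact ihA hfA
    by_cases hfB : ∃ i, ∀ j, (i, j) ∈ B
    · exact ihB hfB
    push Not at hfA hfB
    by_cases hempty : ∃ i, ∀ j, (i, j) ∉ A ∪ B
    · obtain ⟨i, hi⟩ := hA
      obtain ⟨i', hi'⟩ := hempty
      exact ⟨_, h, Or.inr fun j => ⟨⟨i, hi j⟩, ⟨i', hi' j⟩⟩⟩
    · push Not at hempty
      have hcov : (Finset.univ : Finset (Fin p)) ⊆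
          Finset.univ.filter (MixedRow (A ∪ B)) ∪ Finset.univ.filter (MixedRow A) := by
        intro i _
        rw [Finset.mem_union, Finset.mem_filter, Finset.mem_filter]
        by_cases hi : ∃ j, (i, j) ∉ A ∪ B
        · exact Or.inl ⟨Finset.mem_univ _, hempty i, hi⟩
        · push Not at hi
          obtain ⟨j, hj⟩ := hfB i
          exact Or.inr ⟨Finset.mem_univ _, ⟨j, (hi j).resolve_right hj⟩, hfA i⟩
      have hcard := (Finset.card_le_card hcov).trans (Finset.card_union_le _ _)
      rw [Finset.card_univ, Fintype.card_fin] at hcard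
      by_cases h2 : p ≤ 2 * (Finset.univ.filter (MixedRow A)).card
      · exact ⟨A, hA'.holds, Or.inl h2⟩
      · exact ⟨_, h, Or.inl (by omega)⟩

end mixed

/-! ### Lower bounds for the widths of grids. -/

theorem hsuGrid_adj {p q : ℕ} {a b : Fin p × Fin q} : (hsuGrid p q).Adj a b ↔
    ((a.1 : ℕ) + 1 = b.1 ∧ (a.2 : ℕ) = b.2) ∨ ((a.1 : ℕ) ≤ b.1 ∧ (a.2 : ℕ) + 1 = b.2) ∨
    ((b.1 : ℕ) + 1 = a.1 ∧ (b.2 : ℕ) = a.2) ∨ ((b.1 : ℕ) ≤ a.1 ∧ (b.2 : ℕ) + 1 = a.2) := by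
  rw [hsuGrid, SimpleGraph.fromRel_adj, ne_eq, Prod.ext_iff]
  simp only [Fin.ext_iff, Fin.le_def]
  omega

theorem squareGrid_adj {n : ℕ} {a b : Fin n × Fin n} : (squareGrid n).Adj a b ↔
    (((a.1 : ℕ) + 1 = b.1 ∨ (b.1 : ℕ) + 1 = a.1) ∧ (a.2 : ℕ) = b.2) ∨
    (((a.2 : ℕ) + 1 = b.2 ∨ (b.2 : ℕ) + 1 = a.2) ∧ (a.1 : ℕ) = b.1) := by
  rw [squareGrid, SimpleGraph.boxProd_adj, SimpleGraph.pathGraph_adj, SimpleGraph.pathGraph_adj]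
  simp only [Fin.ext_iff]

-- With 4k rows, at least 2k are mixed or all columns are. Horizontal crossing edges are sorted by
-- whether they leave `S` to the right or to the left; one of the two kinds occurs in at least k
-- rows.
open Classical in
theorem le_cliqueWidth_hsuGrid {k : ℕ} (hk : 1 ≤ k) :
    k ≤ (hsuGrid (4 * k) (4 * k)).cliqueWidth := by
  have : NeZero (4 * k) := ⟨by omega⟩
  obtain ⟨S, hS, h⟩ := (hsuGrid (4 * k) (4 * k)).binaryDecomp_cliqueWidth.exists_mixed (by omega)
    ⟨0, fun _ => trivial⟩
  refine le_trans ?_ hS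
  rcases h with h | h
  · let R := Finset.univ.filter fun i : Fin (4 * k) =>
      ∃ a b : Fin (4 * k), (a : ℕ) + 1 = b ∧ (i, a) ∈ S ∧ (i, b) ∉ S
    let L := Finset.univ.filter fun i : Fin (4 * k) =>
      ∃ a b : Fin (4 * k), (b : ℕ) + 1 = a ∧ (i, a) ∈ S ∧ (i, b) ∉ S
    have hsub : Finset.univ.filter (MixedRow S) ⊆ R ∪ L := by
      intro i hi
      obtain ⟨h1, h2⟩ := (Finset.mem_filter.1 hi).2
      obtain ⟨a, b, hab | hab, hs⟩ := exists_adjacent_of_mixed h1 h2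
      · exact Finset.mem_union_left _ (Finset.mem_filter.2 ⟨Finset.mem_univ _, a, b, hab, hs⟩)
      · exact Finset.mem_union_right _ (Finset.mem_filter.2 ⟨Finset.mem_univ _, a, b, hab, hs⟩)
    have hcard := (Finset.card_le_card hsub).trans (Finset.card_union_le _ _)
    have hR : R.card ≤ (hsuGrid (4 * k) (4 * k)).outerClasses S := by
      have hR' : ∀ i ∈ R, ∃ a b : Fin (4 * k), (a : ℕ) + 1 = b ∧ (i, a) ∈ S ∧ (i, b) ∉ S :=
        fun i hi => (Finset.mem_filter.1 hi).2
      choose! a b hab ha hb using hR'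
      refine SimpleGraph.card_le_outerClasses _ R S (fun i => (i, a i)) (fun i => (i, b i)) ha hb
        (fun i hi => ?_) fun i hi j hj h1 h2 => ?_
      · have := hab i hi
        exact hsuGrid_adj.2 (by dsimp only; omega)
      · have := hab i hi
        have := hab j hj
        -- The edges between consecutive columns force the two positions to agree and give i ≤ j and
        -- j ≤ i; every other combination has incompatible columns.
        rw [hsuGrid_adj] at h1 h2
        dsimp only at h1 h2
        apply Fin.ext
        omega
    have hL : L.card ≤ (hsuGrid (4 * k) (4 * k)).outerClasses S := by
      have hL' : ∀ i ∈ L, ∃ a b : Fin (4 * k), (b : ℕ) + 1 = a ∧ (i, a) ∈ S ∧ (i, b) ∉ S :=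
        fun i hi => (Finset.mem_filter.1 hi).2
      choose! a b hab ha hb using hL'
      refine SimpleGraph.card_le_outerClasses _ L S (fun i => (i, a i)) (fun i => (i, b i)) ha hb
        (fun i hi => ?_) fun i hi j hj h1 h2 => ?_
      · have := hab i hi
        exact hsuGrid_adj.2 (by dsimp only; omega)
      · have := hab i hi
        have := hab j hj
        rw [hsuGrid_adj] at h1 h2
        dsimp only at h1 h2
        apply Fin.ext
        omega
    omega
  · let c : Fin k → Fin (4 * k) := fun t => ⟨2 * t, by omega⟩
    choose a b hab ha hb using fun t => exists_adjacent_of_mixed (h (c t)).1 (h (c t)).2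
    have := SimpleGraph.card_le_outerClasses (hsuGrid (4 * k) (4 * k)) Finset.univ S
      (fun t => (a t, c t)) (fun t => (b t, c t)) (fun t _ => ha t) (fun t _ => hb t)
      (fun t _ => ?_) fun t _ s _ h1 h2 => ?_
    · simpa using this
    · have := hab t
      exact hsuGrid_adj.2 (by dsimp only; omega)
    · rw [hsuGrid_adj] at h1
      dsimp only [c] at h1
      apply Fin.ext
      omega

-- Lines of one parity are pairwise non-consecutive, so their crossing edges form an induced
-- matching. At least 6k mixed rows leave 3k of one parity; if all columns are mixed, 3k of those
-- with even index are used.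
open Classical in
theorem le_booleanWidth_squareGrid {k : ℕ} (hk : 1 ≤ k) :
    (3 * k : ℝ) ≤ (squareGrid (12 * k)).booleanWidth := by
  have : NeZero (12 * k) := ⟨by omega⟩
  refine SimpleGraph.le_booleanWidth _ (.true_univ _) fun r hr => ?_
  obtain ⟨S, hS, h⟩ := hr.exists_mixed (by omega) ⟨0, fun _ => trivial⟩
  refine le_trans ?_ hS
  rcases h with h | h
  · have key : ∀ ε : ℕ, ((((Finset.univ.filter (MixedRow S)).filter
        fun i : Fin (12 * k) => (i : ℕ) % 2 = ε).card : ℕ) : ℝ) ≤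
          (squareGrid (12 * k)).booleanCut S := by
      intro ε
      have hM : ∀ i ∈ (Finset.univ.filter (MixedRow S)).filter
            fun i : Fin (12 * k) => (i : ℕ) % 2 = ε,
          ∃ a b : Fin (12 * k), ((a : ℕ) + 1 = b ∨ (b : ℕ) + 1 = a) ∧ (i, a) ∈ S ∧ (i, b) ∉ S := by
        intro i hi
        have hi' := (Finset.mem_filter.1 (Finset.mem_filter.1 hi).1).2
        exact exists_adjacent_of_mixed hi'.1 hi'.2
      choose! a b hab ha hb using hM
      refine SimpleGraph.card_le_booleanCut _ _ S (fun i => (i, a i)) (fun i => (i, b i)) ha hb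
        fun i hi j hj => ?_
      have h1 := hab i hi
      have h2 := (Finset.mem_filter.1 hi).2
      have h3 := (Finset.mem_filter.1 hj).2
      rw [squareGrid_adj]
      dsimp only
      constructor
      · intro h
        apply Fin.ext
        omega
      · rintro rfl
        exact Or.inr ⟨h1, rfl⟩
    have hsub : Finset.univ.filter (MixedRow S) ⊆
        (Finset.univ.filter (MixedRow S)).filter (fun i : Fin (12 * k) => (i : ℕ) % 2 = 0) ∪
        (Finset.univ.filter (MixedRow S)).filter (fun i : Fin (12 * k) => (i : ℕ) % 2 = 1) := by
      intro i hi
      rcases Nat.mod_two_eq_zero_or_one i with h | h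
      · exact Finset.mem_union_left _ (Finset.mem_filter.2 ⟨hi, h⟩)
      · exact Finset.mem_union_right _ (Finset.mem_filter.2 ⟨hi, h⟩)
    have hcard := (Finset.card_le_card hsub).trans (Finset.card_union_le _ _)
    by_cases h0 : 3 * k ≤ ((Finset.univ.filter (MixedRow S)).filter
        (fun i : Fin (12 * k) => (i : ℕ) % 2 = 0)).card
    · exact le_trans (by exact_mod_cast h0) (key 0)
    · refine le_trans ?_ (key 1)
      exact_mod_cast (by omega : 3 * k ≤ _)
  · let c : Fin (3 * k) → Fin (12 * k) := fun t => ⟨2 * t, by omega⟩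
    choose a b hab ha hb using fun t => exists_adjacent_of_mixed (h (c t)).1 (h (c t)).2
    have := SimpleGraph.card_le_booleanCut (squareGrid (12 * k)) Finset.univ S
      (fun t => (a t, c t)) (fun t => (b t, c t)) (fun t _ => ha t) (fun t _ => hb t)
      fun t _ s _ => ?_
    · simpa using this
    · have := hab t
      rw [squareGrid_adj]
      dsimp only [c]
      constructor
      · intro h
        apply Fin.ext
        omega
      · rintro rfl
        omega

/-! ### Upper bounds for the widths of grids. -/

theorem outerClasses_squareGrid_initialPart_le (n l : ℕ) :
    (squareGrid n).outerClasses (initialPart finProdFinEquiv l) ≤ n + 1 := by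
  set S : Set (Fin n × Fin n) := initialPart finProdFinEquiv l with hS
  -- Row by row, adjacent vertices are at most `n` positions apart, so only the last `n` vertices
  -- can have neighbours outside. All others share the empty outer neighbourhood, which accounts for
  -- the extra class.
  let F : Set (Fin n × Fin n) :=
    {x | (finProdFinEquiv x : ℕ) ∈ Finset.Ico (l - n) l}
  have hF : F.ncard ≤ n := by
    refine (Set.ncard_le_ncard_of_injOn (t := (Finset.Ico (l - n) l : Set ℕ))
      (fun x => (finProdFinEquiv x : ℕ)) (fun x hx => hx) ?_ (Set.toFinite _)).trans ?_
    · intro x _ y _ h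
      exact finProdFinEquiv.injective (Fin.ext h)
    · rw [Set.ncard_coe_finset, Nat.card_Ico]
      omega
  have hsub : (fun x => (squareGrid n).neighborSet x \ S) '' S ⊆
      insert ∅ ((fun x => (squareGrid n).neighborSet x \ S) '' F) := by
    rintro _ ⟨x, hx, rfl⟩
    rcases ((squareGrid n).neighborSet x \ S).eq_empty_or_nonempty with h | ⟨z, hz, hzS⟩
    · exact Or.inl h
    · refine Or.inr ⟨x, ?_, rfl⟩
      have hx' : (finProdFinEquiv x : ℕ) < l := hx
      have hz' : ¬ (finProdFinEquiv z : ℕ) < l := hzS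
      refine Finset.mem_Ico.2 ⟨?_, hx'⟩
      suffices (finProdFinEquiv z : ℕ) ≤ finProdFinEquiv x + n by omega
      rw [finProdFinEquiv_apply_val, finProdFinEquiv_apply_val]
      have hxz := squareGrid_adj.1 hz
      have h1 : (z.1 : ℕ) ≤ x.1 + 1 := by omega
      have h2 := Nat.mul_le_mul_left n h1
      rw [Nat.mul_succ] at h2
      rcases hxz with ⟨_, h⟩ | ⟨h, h'⟩
      · omega
      · rw [h']
        have := z.2.2
        omega
  calc (squareGrid n).outerClasses S
      ≤ (insert ∅ ((fun x => (squareGrid n).neighborSet x \ S) '' F)).ncard :=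
        Set.ncard_le_ncard hsub (Set.toFinite _)
    _ ≤ ((fun x => (squareGrid n).neighborSet x \ S) '' F).ncard + 1 := Set.ncard_insert_le _ _
    _ ≤ n + 1 := Nat.add_le_add_right ((Set.ncard_image_le (Set.toFinite _)).trans hF) 1

theorem cliqueWidth_squareGrid_le {n : ℕ} (hn : 0 < n) : (squareGrid n).cliqueWidth ≤ n + 2 :=
  (SimpleGraph.isConstructible_of_initialPart finProdFinEquiv (Nat.mul_pos hn hn)
    (outerClasses_squareGrid_initialPart_le n)).cliqueWidth_le

/-- The threshold is the least admissible `r`; the value `I` encodes that there is none. -/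
theorem exists_threshold_of_lt (I : ℕ) (A : ℕ → Prop) :
    ∃ w ≤ I, ∀ i, (∃ r ≤ i, r < I ∧ A r) ↔ w < I ∧ w ≤ i := by
  classical
  by_cases h : ∃ r, r < I ∧ A r
  · have hs := Nat.find_spec h
    refine ⟨Nat.find h, hs.1.le, fun i => ⟨?_, fun hi => ⟨_, hi.2, hs⟩⟩⟩
    rintro ⟨r, hri, hr⟩
    exact ⟨hs.1, (Nat.find_min' h hr).trans hri⟩
  · refine ⟨I, le_rfl, fun i => ⟨?_, fun hi => (lt_irrefl _ hi.1).elim⟩⟩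
    rintro ⟨r, -, hr⟩
    exact (h ⟨r, hr⟩).elim

/-- Only rows from `I` on are tested, so a smaller threshold may be raised to `I`. -/
theorem exists_threshold_of_le {I p : ℕ} (hI : I ≤ p) (A : ℕ → Prop) :
    ∃ u, I ≤ u ∧ u ≤ p ∧ ∀ i, I ≤ i → i < p → ((∃ r ≤ i, A r) ↔ u ≤ i) := by
  obtain ⟨w, hw, h⟩ := exists_threshold_of_lt p A
  refine ⟨max I w, le_max_left _ _, max_le hI hw, fun i hi hip => ?_⟩
  have h1 : (∃ r ≤ i, A r) ↔ ∃ r ≤ i, r < p ∧ A r :=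
    exists_congr fun r => and_congr_right fun hr => (and_iff_right (hr.trans_lt hip)).symm
  rw [h1, h]
  omega

/-- The enumeration of the vertices of the Hsu-grid column by column. -/
def columnEquiv (p q : ℕ) : Fin p × Fin q ≃ Fin (q * p) :=
  (Equiv.prodComm _ _).trans finProdFinEquiv

theorem mem_initialPart_columnEquiv {p q m : ℕ} (hp : 0 < p) {z : Fin p × Fin q} :
    z ∈ initialPart (columnEquiv p q) m ↔
      (z.2 : ℕ) < m / p ∨ ((z.2 : ℕ) = m / p ∧ (z.1 : ℕ) < m % p) := by
  have hz : ((columnEquiv p q) z : ℕ) = z.1 + p * z.2 := rfl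
  change ((columnEquiv p q) z : ℕ) < m ↔ _
  rw [hz]
  have h1 := Nat.div_add_mod m p
  have h2 := Nat.mod_lt m hp
  have h3 := z.1.2
  constructor
  · intro h
    by_contra! hc
    rcases hc.1.lt_or_eq with h4 | h4
    · have := Nat.mul_le_mul_left p (Nat.succ_le_of_lt h4)
      rw [Nat.mul_succ] at this
      omega
    · have := hc.2 h4.symm
      rw [← h4] at h
      omega
  · rintro (h | ⟨h, h'⟩)
    · have := Nat.mul_le_mul_left p (Nat.succ_le_of_lt h)
      rw [Nat.mul_succ] at this
      omega
    · rw [h]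
      omega

/-- The initial part consists of the columns before J and the first I vertices of column J. A union
of outer neighbourhoods is determined by three data: the threshold in column J caused by column J -
1, the threshold in column J + 1 caused by column J, and one bit for the vertical edge that crosses
the cut inside column J. -/
theorem cutUnions_hsuGrid_initialPart_le {p q : ℕ} (hp : 5 ≤ p) (m : ℕ) :
    ((hsuGrid p q).cutUnions (initialPart (columnEquiv p q) m)).ncard ≤ p ^ 2 := by
  rw [← SimpleGraph.cutUnions_ncard_compl]
  set J := m / p with hJ
  set I := m % p with hI
  have hIp : I < p := Nat.mod_lt m (by omega)
  let S : Set (Fin p × Fin q) := initialPart (columnEquiv p q) m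
  have hS : ∀ z, z ∈ S ↔ (z.2 : ℕ) < J ∨ ((z.2 : ℕ) = J ∧ (z.1 : ℕ) < I) := fun z =>
    mem_initialPart_columnEquiv (by omega)
  let F : ℕ × ℕ × Bool → Set (Fin p × Fin q) := fun t =>
    {z | z ∉ S ∧ (((z.2 : ℕ) = J ∧ t.1 ≤ z.1) ∨ ((z.2 : ℕ) = J + 1 ∧ t.2.1 < I ∧ t.2.1 ≤ z.1) ∨
      (t.2.2 = true ∧ (z.2 : ℕ) = J ∧ (z.1 : ℕ) = I))}
  let K : Finset (ℕ × ℕ × Bool) := Finset.Icc I p ×ˢ Finset.Icc 0 I ×ˢ Finset.univ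
  have hsub : (hsuGrid p q).cutUnions Sᶜ ⊆ F '' K := by
    intro X hX
    obtain ⟨Y, hY, hX⟩ := SimpleGraph.mem_cutUnions _ |>.1 hX
    rw [compl_compl] at hY
    obtain ⟨u, hIu, hup, hu⟩ := exists_threshold_of_le hIp.le
      (fun r => ∃ y ∈ Y, (y.1 : ℕ) = r ∧ (y.2 : ℕ) + 1 = J)
    obtain ⟨w, hwI, hw⟩ := exists_threshold_of_lt I
      (fun r => ∃ y ∈ Y, (y.1 : ℕ) = r ∧ (y.2 : ℕ) = J)
    classical
    refine ⟨(u, w, decide (∃ y ∈ Y, (y.2 : ℕ) = J ∧ (y.1 : ℕ) + 1 = I)), ?_, ?_⟩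
    · exact Finset.mem_coe.2 (Finset.mem_product.2 ⟨Finset.mem_Icc.2 ⟨hIu, hup⟩,
        Finset.mem_product.2 ⟨Finset.mem_Icc.2 ⟨Nat.zero_le _, hwI⟩, Finset.mem_univ _⟩⟩)
    · ext z
      rw [hX]
      refine and_congr_right fun hz => ?_
      rw [hS] at hz
      have hzp := z.1.2
      dsimp only
      rw [← hw, decide_eq_true_eq]
      constructor
      · rintro (⟨hzJ, hzu⟩ | ⟨hzJ, r, hr, hrI, y, hy, hyr, hyJ⟩ | ⟨⟨y, hy, hyJ, hyI⟩, hzJ, hzI⟩)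
        · obtain ⟨r, hr, y, hy, hyr, hyJ⟩ := (hu z.1 (by omega) hzp).2 hzu
          exact ⟨y, hy, hsuGrid_adj.2 (by omega)⟩
        · exact ⟨y, hy, hsuGrid_adj.2 (by omega)⟩
        · exact ⟨y, hy, hsuGrid_adj.2 (by omega)⟩
      · rintro ⟨y, hy, hyz⟩
        have hyS := (hS y).1 (hY hy)
        rw [hsuGrid_adj] at hyz
        by_cases h1 : (z.2 : ℕ) = J + 1
        · exact Or.inr (Or.inl ⟨h1, y.1, by omega, by omega, y, hy, rfl, by omega⟩)
        · by_cases h2 : (y.2 : ℕ) = J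
          · exact Or.inr (Or.inr ⟨⟨y, hy, h2, by omega⟩, by omega, by omega⟩)
          · exact Or.inl ⟨by omega, (hu z.1 (by omega) hzp).1
              ⟨y.1, by omega, y, hy, rfl, by omega⟩⟩
  calc ((hsuGrid p q).cutUnions Sᶜ).ncard ≤ (F '' K).ncard :=
        Set.ncard_le_ncard hsub (Set.toFinite _)
    _ ≤ K.card := by
        rw [← Set.ncard_coe_finset]
        exact Set.ncard_image_le (Set.toFinite _)
    _ = (p + 1 - I) * ((I + 1) * 2) := by simp [K]
    _ ≤ p ^ 2 := by
        obtain ⟨x, hx⟩ : ∃ x, p = I + x := ⟨p - I, by omega⟩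
        have h1 : p + 1 - I = x + 1 := by omega
        rw [h1]
        zify at hx hp ⊢
        -- By the arithmetic-geometric inequality, 2(x + 1)(I + 1) ≤ (p + 2)²/2, which is at most p²
        -- once p ≥ 5.
        nlinarith [sq_nonneg ((x : ℤ) - I)]

theorem booleanWidth_hsuGrid_le {p q : ℕ} (hp : 5 ≤ p) (hq : 0 < q) :
    (hsuGrid p q).booleanWidth ≤ 2 * Real.logb 2 p := by
  have hp' : (5 : ℝ) ≤ p := by exact_mod_cast hp
  refine SimpleGraph.booleanWidth_le _ (.of_initialPart (columnEquiv p q) (fun v => ?_)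
    (fun m _ _ => ?_) (Nat.mul_pos hq (by omega)))
  · refine ((hsuGrid p q).booleanCut_le_outerClasses _).trans ?_
    rw [SimpleGraph.outerClasses_singleton]
    have : 1 ≤ Real.logb 2 p := by
      rw [Real.le_logb_iff_rpow_le one_lt_two (by linarith), Real.rpow_one]
      linarith
    push_cast
    linarith
  · have h1 := (hsuGrid p q).one_le_cutUnions (initialPart (columnEquiv p q) m)
    rw [SimpleGraph.booleanCut_eq, ← Nat.cast_ofNat (R := ℝ) (n := 2), ← Real.logb_pow]
    refine Real.logb_le_logb_of_le (by norm_num) (by exact_mod_cast h1) ?_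
    exact_mod_cast cutUnions_hsuGrid_initialPart_le hp m

theorem theorem2 :
    (∀ {V : Type*} [Finite V] [Nonempty V] (G : SimpleGraph V),
      Real.logb 2 (G.cliqueWidth : ℝ) - 1 ≤ G.booleanWidth ∧
        G.booleanWidth ≤ (G.cliqueWidth : ℝ)) ∧
    ∃ k₀ : ℕ, ∀ k : ℕ, k₀ ≤ k →
      (∃ p q : ℕ, 2 ≤ p ∧ 2 ≤ q ∧
        k ≤ (hsuGrid p q).cliqueWidth ∧
        (hsuGrid p q).booleanWidth ≤ 2 * Real.logb 2 ((hsuGrid p q).cliqueWidth : ℝ) + 4) ∧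
      (∃ n : ℕ, 1 ≤ n ∧
        k ≤ (squareGrid n).cliqueWidth ∧
        ((⌊(1 / 6 : ℝ) * ((squareGrid n).cliqueWidth : ℝ)⌋ : ℤ) : ℝ) - 1 ≤
          (squareGrid n).booleanWidth) := by
  -- The constant `2` ensures 4k ≥ 5, as needed for the bound p² on the number of unions.
  refine ⟨fun G => ⟨G.logb_cliqueWidth_sub_one_le, G.booleanWidth_le_cliqueWidth⟩, 2,
    fun k hk => ⟨⟨4 * k, 4 * k, by omega, by omega, le_cliqueWidth_hsuGrid (by omega), ?_⟩,
      12 * k, by omega, ?_, ?_⟩⟩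
  · have hk' : (2 : ℝ) ≤ k := by exact_mod_cast hk
    refine (booleanWidth_hsuGrid_le (by omega) (by omega)).trans ?_
    have h1 : Real.logb 2 ((4 * k : ℕ) : ℝ) = 2 + Real.logb 2 k := by
      have h4 : (4 : ℝ) = 2 ^ (2 : ℝ) := by norm_num
      push_cast
      rw [Real.logb_mul (by norm_num) (by linarith), h4, Real.logb_rpow two_pos (by norm_num)]
    have h2 : Real.logb 2 k ≤ Real.logb 2 (hsuGrid (4 * k) (4 * k)).cliqueWidth :=
      Real.logb_le_logb_of_le one_lt_two (by linarith)
        (by exact_mod_cast le_cliqueWidth_hsuGrid (by omega))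
    rw [h1]
    linarith
  · have : NeZero (12 * k) := ⟨by omega⟩
    have h := (le_booleanWidth_squareGrid (k := k) (by omega)).trans
      (SimpleGraph.booleanWidth_le_cliqueWidth _)
    have h' : 3 * k ≤ (squareGrid (12 * k)).cliqueWidth := by exact_mod_cast h
    omega
  · have h := le_booleanWidth_squareGrid (k := k) (by omega)
    have hc : ((squareGrid (12 * k)).cliqueWidth : ℝ) ≤ 12 * k + 2 := by
      exact_mod_cast cliqueWidth_squareGrid_le (n := 12 * k) (by omega)
    have hf := Int.floor_le ((1 / 6 : ℝ) * ((squareGrid (12 * k)).cliqueWidth : ℝ))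
    have hk' : (2 : ℝ) ≤ k := by exact_mod_cast hk
    -- Here (12k + 2)/6 - 1 < 2k, well below the lower bound 3k.
    linarith

end
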